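/- Write $|\cdot|$ for area (Lebesgue measure) in the Euclidean plane $\mathbb{R}^2$. A convex body is a compact convex set with non-empty interior, and a (proper) convex quadrangle is the convex hull of four points, none of which lies in the convex hull of the other three. For every convex body $K \subset \mathbb{R}^2$ there exists a convex quadrangle $Q$ with $K \subset Q$ and $$|Q| < (1 - 2.6\cdot 10^{-7})\,\sqrt{2}\,|K|.$$ Consequently, if $$c_4 = \sup_{K}\ \inf_{P \supset K} \frac{|P|}{|K|},$$ where $K$ ranges over all convex bodies in $\mathbb{R}^2$ and $P$ over all convex polygons with at most four sides that contain $K$, then $c_4 \le (1 - 2.6\cdot 10^{-7})\,\sqrt{2}$. -/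

import Mathlib

open MeasureTheory Set
open scoped ENNReal

/-- The Euclidean plane; `volume` on it is Lebesgue area. -/
abbrev Plane : Type := EuclideanSpace ℝ (Fin 2)

/-- A convex body in the plane: a compact convex set with non-empty interior. -/
structure IsPlanarConvexBody (K : Set Plane) : Prop where
  convex : Convex ℝ K
  isCompact : IsCompact K
  interior_nonempty : (interior K).Nonempty

/-- A proper convex quadrangle (as a closed region): the convex hull of four points in convex
position, i.e. none of the four points lies in the convex hull of the other three. -/
def IsConvexQuadrangle (Q : Set Plane) : Prop :=
  ∃ v : Fin 4 → Plane, ConvexIndependent ℝ v ∧ Q = convexHull ℝ (range v)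

/-- The convex hull of at most four points. Such a set with non-empty interior is exactly a
convex polygon with at most four sides. -/
def IsHullOfAtMostFour (P : Set Plane) : Prop :=
  ∃ v : Fin 4 → Plane, P = convexHull ℝ (range v)

/-- The constant `c₄`: the supremum over all planar convex bodies `K` of the least possible
ratio `|P| / |K|`, where `P ⊇ K` is a convex polygon with at most four sides. -/
noncomputable def c4 : ℝ≥0∞ :=
  ⨆ (K : Set Plane) (_ : IsPlanarConvexBody K),
    ⨅ (P : Set Plane) (_ : IsHullOfAtMostFour P ∧ K ⊆ P), volume P / volume K

/-!
Let `V` be a parallelogram of maximal area inscribed in the convex body `K`; by an affine map `V`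
becomes the unit square. Lagrange multipliers for the maximality of `V`
(`exists_isBalanced_of_unitSquare_max`) give four lines bounding `K`, one through each corner of
`V`, that enclose a quadrangle of area `2` (`IsBalanced`). Let `H` and `W` be the height and the
width of the bounding box of `K`. The square and four triangles erected on its sides show
`|K| ≥ (H + W) / 2`, while the box has area `H W ≤ |K|²`. Thus the product of the areas of the two
circumscribed quadrangles is at most `2 |K|²`, and one of them has area at most `√2 |K|`.

Suppose that no quadrangle beats the slightly smaller constant. Then all these estimates are nearly
equalities (`near_square_of_ratioBound_mul_le`): `H` and `W` are close to `√2`, and `K` nearly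
coincides with the octagon spanned by the square and the points where `K` touches its box. By
symmetry `K` extends at least as far above the square as below it, and at least as far to the right
as to the left. Tilt the top and the right side of the box about their contact points by the same
small angle, both clockwise or both counterclockwise. Since `K` is close to the octagon, the tilted
lines have to be moved outwards only very little to clear `K` (`IsBalanced.top_support_right` and
its three companions). The first-order changes of area for the two senses of rotation cancel, and
in second order the average area drops by a definite amount, at least about `0.006`, which exceeds
all error terms. So one of the two tilted quadrangles is too small, a contradiction
(`IsBalanced.hasSmallQuadrangle_of_le`).
-/

/-! ### Affine frames and triangles in the coordinate plane -/

/-- Twice the signed area of the triangle `a b c`. -/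
def dblArea (a b c : ℝ × ℝ) : ℝ :=
  (b.1 - a.1) * (c.2 - a.2) - (b.2 - a.2) * (c.1 - a.1)

/-- The affine map of the plane with origin `o` and axis vectors `u` and `w`:
`(s, t) ↦ o + s u + t w`. -/
noncomputable def frameMap (o u w : ℝ × ℝ) : ℝ × ℝ →ᵃ[ℝ] ℝ × ℝ where
  toFun p := (o.1 + (u.1 * p.1 + w.1 * p.2), o.2 + (u.2 * p.1 + w.2 * p.2))
  linear := Matrix.toLin (Module.Basis.finTwoProd ℝ) (Module.Basis.finTwoProd ℝ)
    !![u.1, w.1; u.2, w.2]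
  map_vadd' p v := by
    rw [Matrix.toLin_finTwoProd_apply]
    ext <;> simp <;> ring

theorem frameMap_apply (o u w p : ℝ × ℝ) :
    frameMap o u w p = (o.1 + (u.1 * p.1 + w.1 * p.2), o.2 + (u.2 * p.1 + w.2 * p.2)) := rfl

theorem volume_frameMap_image (o u w : ℝ × ℝ) (s : Set (ℝ × ℝ)) :
    volume (frameMap o u w '' s) = ENNReal.ofReal |u.1 * w.2 - u.2 * w.1| * volume s := by
  have h : frameMap o u w '' s = (fun x => o + x) '' ((Matrix.toLin (Module.Basis.finTwoProd ℝ)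
      (Module.Basis.finTwoProd ℝ) !![u.1, w.1; u.2, w.2]) '' s) := by
    rw [image_image]
    refine image_congr fun p _ => ?_
    rw [Matrix.toLin_finTwoProd_apply, frameMap_apply]
    rfl
  rw [h, image_add_left, measure_preimage_add, Measure.addHaar_image_linearMap,
    LinearMap.det_toLin, Matrix.det_fin_two_of]
  ring_nf

theorem frameMap_injective {o u w : ℝ × ℝ} (h : u.1 * w.2 - u.2 * w.1 ≠ 0) :
    Function.Injective (frameMap o u w) := by
  intro p q hpq
  rw [frameMap_apply, frameMap_apply, Prod.mk.injEq] at hpq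
  obtain ⟨h1, h2⟩ := hpq
  ext
  · apply mul_left_cancel₀ h
    linear_combination w.2 * h1 - w.1 * h2
  · apply mul_left_cancel₀ h
    linear_combination u.1 * h2 - u.2 * h1

theorem frameMap_surjective {o u w : ℝ × ℝ} (h : u.1 * w.2 - u.2 * w.1 ≠ 0) :
    Function.Surjective (frameMap o u w) := by
  intro x
  refine ⟨((w.2 * (x.1 - o.1) - w.1 * (x.2 - o.2)) / (u.1 * w.2 - u.2 * w.1),
    (u.1 * (x.2 - o.2) - u.2 * (x.1 - o.1)) / (u.1 * w.2 - u.2 * w.1)), ?_⟩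
  rw [frameMap_apply]
  have hinv := mul_inv_cancel₀ h
  ext
  · linear_combination (x.1 - o.1) * hinv
  · linear_combination (x.2 - o.2) * hinv

/-- The open triangle `{0 < x, 0 < y, x + y < 1}` has area `1 / 2`. -/
theorem volume_openStdTriangle :
    volume {p : ℝ × ℝ | 0 < p.1 ∧ 0 < p.2 ∧ p.1 + p.2 < 1} = ENNReal.ofReal (1 / 2) := by
  have h : {p : ℝ × ℝ | 0 < p.1 ∧ 0 < p.2 ∧ p.1 + p.2 < 1} =
      regionBetween (fun _ => 0) (fun x : ℝ => 1 - x) (Ioc 0 1) := by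
    ext p
    simp only [mem_ofPred_eq, regionBetween, mem_Ioc, mem_Ioo]
    constructor
    · rintro ⟨h1, h2, h3⟩
      exact ⟨⟨h1, by linarith⟩, h2, by linarith⟩
    · rintro ⟨⟨h1, _⟩, h2, h3⟩
      exact ⟨h1, h2, by linarith⟩
  rw [h, Measure.volume_eq_prod, volume_regionBetween_eq_integral (by simp)
    ((Continuous.integrableOn_Icc (by fun_prop)).mono_set Ioc_subset_Icc_self) measurableSet_Ioc
    (by simp)]
  rw [← intervalIntegral.integral_of_le zero_le_one]
  congr 1
  simp only [Pi.sub_apply, sub_zero]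
  rw [intervalIntegral.integral_sub (by simp) (by simp)]
  simp
  norm_num

/-- The closed triangle is no larger than the open one, as the boundary of a convex set is null. -/
theorem volume_closedStdTriangle_le :
    volume {p : ℝ × ℝ | 0 ≤ p.1 ∧ 0 ≤ p.2 ∧ p.1 + p.2 ≤ 1} ≤ ENNReal.ofReal (1 / 2) := by
  set T : Set (ℝ × ℝ) := {p : ℝ × ℝ | 0 ≤ p.1 ∧ 0 ≤ p.2 ∧ p.1 + p.2 ≤ 1} with hT
  have hconv : Convex ℝ T := by
    rintro p ⟨p1, p2, p3⟩ q ⟨q1, q2, q3⟩ a b ha hb hab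
    refine ⟨?_, ?_, ?_⟩ <;> simp <;> try positivity
    nlinarith
  have hint : interior T ⊆ {p : ℝ × ℝ | 0 < p.1 ∧ 0 < p.2 ∧ p.1 + p.2 < 1} := by
    intro p hp
    obtain ⟨ε, hε, hball⟩ := Metric.isOpen_iff.1 isOpen_interior p hp
    have key : ∀ a b : ℝ, |a| < ε → |b| < ε → (p.1 + a, p.2 + b) ∈ T := fun a b ha hb => by
      refine interior_subset (hball ?_)
      simp [Prod.dist_eq, ha, hb]
    have he : |ε / 2| < ε := by rw [abs_of_pos] <;> linarith
    have he' : |-(ε / 2)| < ε := by rw [abs_neg]; exact he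
    have h1 := key _ _ he' he'
    have h2 := key _ _ he he
    simp only [hT, mem_ofPred_eq] at h1 h2
    exact ⟨by linarith, by linarith, by linarith⟩
  calc volume T ≤ volume (interior T ∪ frontier T) := measure_mono (by
          rw [← closure_eq_interior_union_frontier]; exact subset_closure)
    _ ≤ volume (interior T) + volume (frontier T) := measure_union_le _ _
    _ = volume (interior T) := by rw [hconv.addHaar_frontier volume, add_zero]
    _ ≤ _ := (measure_mono hint).trans volume_openStdTriangle.le

/-- The open triangle with counterclockwise vertices `a b c`. -/
def openTriangle (a b c : ℝ × ℝ) : Set (ℝ × ℝ) :=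
  {x | 0 < dblArea a b x ∧ 0 < dblArea b c x ∧ 0 < dblArea c a x}

theorem dblArea_add_add (a b c x : ℝ × ℝ) :
    dblArea a b x + dblArea b c x + dblArea c a x = dblArea a b c := by
  unfold dblArea; ring

theorem isOpen_openTriangle (a b c : ℝ × ℝ) : IsOpen (openTriangle a b c) := by
  unfold openTriangle dblArea
  apply_rules [IsOpen.and, isOpen_lt] <;> fun_prop

/-- Barycentric coordinates with respect to the triangle `a b c`. -/
theorem eq_frameMap_barycentric {a b c : ℝ × ℝ} (h : 0 < dblArea a b c) (x : ℝ × ℝ) :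
    frameMap a (b - a) (c - a) (dblArea c a x / dblArea a b c, dblArea a b x / dblArea a b c)
      = x := by
  rw [frameMap_apply]
  have h' := h.ne'
  ext <;> dsimp only <;> field_simp <;> unfold dblArea <;> simp <;> ring

theorem volume_openTriangle {a b c : ℝ × ℝ} (h : 0 ≤ dblArea a b c) :
    volume (openTriangle a b c) = ENNReal.ofReal (dblArea a b c / 2) := by
  rcases h.eq_or_lt with h0 | h
  · have : openTriangle a b c = ∅ := by
      refine eq_empty_of_forall_notMem ?_
      rintro x ⟨h1, h2, h3⟩
      have := dblArea_add_add a b c x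
      linarith
    rw [this, ← h0]; simp
  have him : openTriangle a b c = frameMap a (b - a) (c - a) ''
      {p : ℝ × ℝ | 0 < p.1 ∧ 0 < p.2 ∧ p.1 + p.2 < 1} := by
    ext x
    constructor
    · rintro ⟨h1, h2, h3⟩
      refine ⟨_, ⟨div_pos h3 h, div_pos h1 h, ?_⟩, eq_frameMap_barycentric h x⟩
      dsimp only
      rw [← add_div, div_lt_one h]
      linarith [dblArea_add_add a b c x]
    · rintro ⟨p, ⟨h1, h2, h3⟩, rfl⟩
      have e1 : dblArea a b (frameMap a (b - a) (c - a) p) = p.2 * dblArea a b c := by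
        rw [frameMap_apply]; unfold dblArea; simp; ring
      have e3 : dblArea c a (frameMap a (b - a) (c - a) p) = p.1 * dblArea a b c := by
        rw [frameMap_apply]; unfold dblArea; simp; ring
      have e2 : dblArea b c (frameMap a (b - a) (c - a) p)
          = (1 - p.1 - p.2) * dblArea a b c := by
        rw [frameMap_apply]; unfold dblArea; simp; ring
      refine ⟨?_, ?_, ?_⟩
      · rw [e1]; positivity
      · rw [e2]; exact mul_pos (by linarith) h
      · rw [e3]; positivity
  rw [him, volume_frameMap_image, volume_openStdTriangle, ← ENNReal.ofReal_mul (abs_nonneg _)]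
  have : (b - a).1 * (c - a).2 - (b - a).2 * (c - a).1 = dblArea a b c := by
    unfold dblArea; simp
  rw [this, abs_of_pos h]
  ring_nf

theorem volume_closedTriangle_le {a b c : ℝ × ℝ} (h : 0 < dblArea a b c) :
    volume {x | 0 ≤ dblArea a b x ∧ 0 ≤ dblArea b c x ∧ 0 ≤ dblArea c a x} ≤
      ENNReal.ofReal (dblArea a b c / 2) := by
  have him : {x | 0 ≤ dblArea a b x ∧ 0 ≤ dblArea b c x ∧ 0 ≤ dblArea c a x} ⊆
      frameMap a (b - a) (c - a) '' {p : ℝ × ℝ | 0 ≤ p.1 ∧ 0 ≤ p.2 ∧ p.1 + p.2 ≤ 1} := by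
    rintro x ⟨h1, h2, h3⟩
    refine ⟨_, ⟨div_nonneg h3 h.le, div_nonneg h1 h.le, ?_⟩, eq_frameMap_barycentric h x⟩
    dsimp only
    rw [← add_div, div_le_one h]
    linarith [dblArea_add_add a b c x]
  refine (measure_mono him).trans ?_
  rw [volume_frameMap_image]
  refine (mul_le_mul_right volume_closedStdTriangle_le _).trans ?_
  rw [← ENNReal.ofReal_mul (abs_nonneg _)]
  have : (b - a).1 * (c - a).2 - (b - a).2 * (c - a).1 = dblArea a b c := by
    unfold dblArea; simp
  rw [this, abs_of_pos h]
  apply le_of_eq; ring_nf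

theorem mem_convex_of_dblArea_nonneg {a b c x : ℝ × ℝ} {C : Set (ℝ × ℝ)} (hC : Convex ℝ C)
    (ha : a ∈ C) (hb : b ∈ C) (hc : c ∈ C) (h : 0 < dblArea a b c)
    (h1 : 0 ≤ dblArea a b x) (h2 : 0 ≤ dblArea b c x) (h3 : 0 ≤ dblArea c a x) : x ∈ C := by
  have hx : x = (dblArea b c x / dblArea a b c) • a + (dblArea c a x / dblArea a b c) • b +
      (dblArea a b x / dblArea a b c) • c := by
    have h' := h.ne'
    ext <;> simp <;> field_simp <;> unfold dblArea <;> ring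
  have hs : dblArea b c x / dblArea a b c + dblArea c a x / dblArea a b c +
      dblArea a b x / dblArea a b c = 1 := by
    rw [← add_div, ← add_div, div_eq_one_iff_eq h.ne']
    linarith [dblArea_add_add a b c x]
  rw [hx]
  have key := hC.sum_mem (t := Finset.univ)
    (w := ![dblArea b c x / dblArea a b c, dblArea c a x / dblArea a b c,
      dblArea a b x / dblArea a b c]) (z := ![a, b, c])
    (by intro i _; fin_cases i <;> simp <;> positivity)
    (by simp [Fin.sum_univ_three, hs]) (by intro i _; fin_cases i <;> simpa)
  simpa [Fin.sum_univ_three] using key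

/-- Two triangles glued along the edge `a c` bound the area of a convex set from below. Only the
open triangles have to lie in `U`, so that `U` may be an open half-plane with vertices on its
boundary line. -/
theorem dblArea_add_le_volume {K : Set (ℝ × ℝ)} (hK : Convex ℝ K) (hfin : volume K ≠ ∞)
    {a b c d : ℝ × ℝ} (ha : a ∈ K) (hb : b ∈ K) (hc : c ∈ K) (hd : d ∈ K)
    (h1 : 0 ≤ dblArea a b c) (h2 : 0 ≤ dblArea a c d) {U : Set (ℝ × ℝ)}
    (hU1 : openTriangle a b c ⊆ U) (hU2 : openTriangle a c d ⊆ U) :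
    (dblArea a b c + dblArea a c d) / 2 ≤ volume.real (K ∩ U) := by
  have hsub : ∀ p q r : ℝ × ℝ, p ∈ K → q ∈ K → r ∈ K → openTriangle p q r ⊆ K := by
    rintro p q r hp hq hr x ⟨x1, x2, x3⟩
    refine mem_convex_of_dblArea_nonneg hK hp hq hr ?_ x1.le x2.le x3.le
    linarith [dblArea_add_add p q r x]
  have hdisj : Disjoint (openTriangle a b c) (openTriangle a c d) := by
    rw [Set.disjoint_left]
    rintro x ⟨_, _, h⟩ ⟨h', _, _⟩
    have : dblArea c a x = - dblArea a c x := by unfold dblArea; ring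
    linarith
  have hle : volume (openTriangle a b c ∪ openTriangle a c d) ≤ volume (K ∩ U) :=
    measure_mono (union_subset (subset_inter (hsub _ _ _ ha hb hc) hU1)
      (subset_inter (hsub _ _ _ ha hc hd) hU2))
  rw [measure_union hdisj (isOpen_openTriangle _ _ _).measurableSet, volume_openTriangle h1,
    volume_openTriangle h2, ← ENNReal.ofReal_add (by linarith) (by linarith)] at hle
  have hfin' : volume (K ∩ U) ≠ ∞ := ((measure_mono inter_subset_left).trans_lt hfin.lt_top).ne
  rw [Measure.real, ← ENNReal.ofReal_le_iff_le_toReal hfin', add_div]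
  exact hle

/-! ### Convex quadrangles with counterclockwise vertices -/

theorem dblArea_rotate (a b c : ℝ × ℝ) : dblArea a b c = dblArea b c a := by
  unfold dblArea; ring

theorem dblArea_swap (a b c : ℝ × ℝ) : dblArea a b c = - dblArea b a c := by
  unfold dblArea; ring

theorem dblArea_self_left (a b : ℝ × ℝ) : dblArea a b a = 0 := by
  unfold dblArea; ring

theorem dblArea_self_right (a b : ℝ × ℝ) : dblArea a b b = 0 := by
  unfold dblArea; ring

theorem convex_dblArea_nonneg (a b : ℝ × ℝ) : Convex ℝ {x | 0 ≤ dblArea a b x} := by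
  intro x hx y hy s t hs ht hst
  simp only [mem_ofPred_eq] at *
  have : dblArea a b (s • x + t • y) = s * dblArea a b x + t * dblArea a b y := by
    have hs' : s = 1 - t := by linarith
    subst hs'
    unfold dblArea; simp; ring
  rw [this]; positivity

/-- Each vertex is cut off from the other three by the diagonal through its neighbours. -/
theorem convexIndependent_of_dblArea_pos {v : Fin 4 → ℝ × ℝ}
    (h0 : 0 < dblArea (v 0) (v 1) (v 2)) (h1 : 0 < dblArea (v 1) (v 2) (v 3))
    (h2 : 0 < dblArea (v 2) (v 3) (v 0)) (h3 : 0 < dblArea (v 3) (v 0) (v 1)) :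
    ConvexIndependent ℝ v := by
  have key : ∀ i j k l : Fin 4, (∀ m, m = i ∨ m = j ∨ m = k ∨ m = l) →
      0 < dblArea (v j) (v i) (v k) → 0 < dblArea (v k) (v l) (v j) →
      ∀ s : Set (Fin 4), v i ∈ convexHull ℝ (v '' s) → i ∈ s := by
    intro i j k l hm hi hl s hs
    by_contra his
    have : v i ∈ {x | 0 ≤ dblArea (v j) (v k) x} := by
      refine convexHull_min ?_ (convex_dblArea_nonneg _ _) hs
      rintro _ ⟨m, hms, rfl⟩
      simp only [mem_ofPred_eq]
      rcases hm m with rfl | rfl | rfl | rfl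
      · exact absurd hms his
      · rw [dblArea_self_left]
      · rw [dblArea_self_right]
      · rw [dblArea_rotate]; exact hl.le
    simp only [mem_ofPred_eq] at this
    rw [dblArea_rotate, dblArea_rotate, dblArea_swap] at this
    linarith
  intro s i
  fin_cases i
  · exact key 0 3 1 2 (by decide) h3 h1 s
  · exact key 1 0 2 3 (by decide) h0 h2 s
  · exact key 2 1 3 0 (by decide) h1 h3 s
  · exact key 3 2 0 1 (by decide) h2 h0 s

/-- A quadrangle is the union of the two triangles cut by the diagonal `v 0, v 2`. -/
theorem mem_convexHull_of_dblArea_nonneg {v : Fin 4 → ℝ × ℝ}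
    (h0 : 0 < dblArea (v 0) (v 1) (v 2)) (h2 : 0 < dblArea (v 2) (v 3) (v 0)) {x : ℝ × ℝ}
    (k0 : 0 ≤ dblArea (v 0) (v 1) x) (k1 : 0 ≤ dblArea (v 1) (v 2) x)
    (k2 : 0 ≤ dblArea (v 2) (v 3) x) (k3 : 0 ≤ dblArea (v 3) (v 0) x) :
    x ∈ convexHull ℝ (range v) := by
  have hv : ∀ i, v i ∈ convexHull ℝ (range v) := fun i => subset_convexHull ℝ _ ⟨i, rfl⟩
  have e := dblArea_swap (v 2) (v 0) x
  rcases le_total 0 (dblArea (v 2) (v 0) x) with h | h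
  · exact mem_convex_of_dblArea_nonneg (convex_convexHull ℝ _) (hv 0) (hv 1) (hv 2) h0 k0 k1 h
  · exact mem_convex_of_dblArea_nonneg (convex_convexHull ℝ _) (hv 2) (hv 3) (hv 0) h2 k2 k3
      (by linarith)

theorem volume_convexHull_range_le {v : Fin 4 → ℝ × ℝ}
    (h0 : 0 < dblArea (v 0) (v 1) (v 2)) (h1 : 0 < dblArea (v 1) (v 2) (v 3))
    (h2 : 0 < dblArea (v 2) (v 3) (v 0)) (h3 : 0 < dblArea (v 3) (v 0) (v 1)) :
    volume.real (convexHull ℝ (range v)) ≤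
      (dblArea (v 0) (v 1) (v 2) + dblArea (v 2) (v 3) (v 0)) / 2 := by
  have hside : ∀ i j k l : Fin 4, (∀ m, m = i ∨ m = j ∨ m = k ∨ m = l) →
      0 < dblArea (v i) (v j) (v k) → 0 < dblArea (v l) (v i) (v j) →
      convexHull ℝ (range v) ⊆ {x | 0 ≤ dblArea (v i) (v j) x} := by
    intro i j k l hm hk hl
    refine convexHull_min ?_ (convex_dblArea_nonneg _ _)
    rintro _ ⟨m, rfl⟩
    simp only [mem_ofPred_eq]
    rcases hm m with rfl | rfl | rfl | rfl
    · rw [dblArea_self_left]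
    · rw [dblArea_self_right]
    · exact hk.le
    · rw [← dblArea_rotate]; exact hl.le
  have s0 := hside 0 1 2 3 (by decide) h0 h3
  have s1 := hside 1 2 3 0 (by decide) h1 h0
  have s2 := hside 2 3 0 1 (by decide) h2 h1
  have s3 := hside 3 0 1 2 (by decide) h3 h2
  have hsub : convexHull ℝ (range v) ⊆
      {x | 0 ≤ dblArea (v 0) (v 1) x ∧ 0 ≤ dblArea (v 1) (v 2) x ∧ 0 ≤ dblArea (v 2) (v 0) x} ∪
      {x | 0 ≤ dblArea (v 2) (v 3) x ∧ 0 ≤ dblArea (v 3) (v 0) x ∧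
        0 ≤ dblArea (v 0) (v 2) x} := by
    intro x hx
    have e := dblArea_swap (v 2) (v 0) x
    rcases le_total 0 (dblArea (v 2) (v 0) x) with h | h
    · exact Or.inl ⟨s0 hx, s1 hx, h⟩
    · exact Or.inr ⟨s2 hx, s3 hx, by linarith⟩
  have hle := (measure_mono hsub).trans ((measure_union_le (μ := volume) _ _).trans
    (add_le_add (volume_closedTriangle_le h0) (volume_closedTriangle_le h2)))
  rw [← ENNReal.ofReal_add (by linarith) (by linarith)] at hle
  rw [add_div]
  exact ENNReal.toReal_le_of_le_ofReal (by linarith) hle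

/-! ### Bodies with a small circumscribed quadrangle -/

/-- The constant `(1 - 2.6 · 10⁻⁷) √2` of the theorem. -/
noncomputable def ratioBound : ℝ := (1 - 2.6 * 10 ^ (-7 : ℤ)) * √2

/-- `K` lies in a proper convex quadrangle of area less than `ratioBound` times that of `K`. -/
def HasSmallQuadrangle {E : Type*} [AddCommGroup E] [Module ℝ E] [MeasureSpace E]
    (K : Set E) : Prop :=
  ∃ v : Fin 4 → E, ConvexIndependent ℝ v ∧ K ⊆ convexHull ℝ (range v) ∧
    volume.real (convexHull ℝ (range v)) < ratioBound * volume.real K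

theorem hasSmallQuadrangle_of_dblArea {K : Set (ℝ × ℝ)} {a b c d : ℝ × ℝ}
    (h0 : 0 < dblArea a b c) (h1 : 0 < dblArea b c d) (h2 : 0 < dblArea c d a)
    (h3 : 0 < dblArea d a b)
    (hK : ∀ x ∈ K, 0 ≤ dblArea a b x ∧ 0 ≤ dblArea b c x ∧ 0 ≤ dblArea c d x ∧ 0 ≤ dblArea d a x)
    (hvol : (dblArea a b c + dblArea c d a) / 2 < ratioBound * volume.real K) :
    HasSmallQuadrangle K :=
  ⟨![a, b, c, d], convexIndependent_of_dblArea_pos (v := ![a, b, c, d]) h0 h1 h2 h3,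
    fun x hx => mem_convexHull_of_dblArea_nonneg (v := ![a, b, c, d]) h0 h2 (hK x hx).1
      (hK x hx).2.1 (hK x hx).2.2.1 (hK x hx).2.2.2,
    (volume_convexHull_range_le (v := ![a, b, c, d]) h0 h1 h2 h3).trans_lt hvol⟩

/-- Affine maps that scale all areas by the same factor preserve the property. -/
theorem HasSmallQuadrangle.image {E F : Type*} [AddCommGroup E] [Module ℝ E] [MeasureSpace E]
    [AddCommGroup F] [Module ℝ F] [MeasureSpace F] {K : Set E} (h : HasSmallQuadrangle K)
    (f : E →ᵃ[ℝ] F) (hf : Function.Injective f) {c : ℝ} (hc : 0 < c)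
    (hvol : ∀ s : Set E, volume.real (f '' s) = c * volume.real s) :
    HasSmallQuadrangle (f '' K) := by
  obtain ⟨v, hv, hK, hlt⟩ := h
  have him : ∀ s : Set (Fin 4), convexHull ℝ ((f ∘ v) '' s) = f '' convexHull ℝ (v '' s) := by
    intro s
    rw [image_comp, f.image_convexHull]
  have hr : convexHull ℝ (range (f ∘ v)) = f '' convexHull ℝ (range v) := by
    rw [← image_univ, him, image_univ]
  refine ⟨f ∘ v, ?_, ?_, ?_⟩
  · intro s i hi
    rw [him, Function.comp_apply, hf.mem_set_image] at hi
    exact hv s i hi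
  · rw [hr]; exact image_mono hK
  · rw [hr, hvol, hvol]
    nlinarith

/-! ### Bodies in balanced position around the unit square -/

/-- `K` contains the unit square, and each corner of the square lies on a line bounding `K`. The
four lines depend on two parameters `A, B` and enclose a quadrangle of area `2` whose sides have
the corners of the square as midpoints. -/
structure IsBalanced (K : Set (ℝ × ℝ)) (A B : ℝ) : Prop where
  convex : Convex ℝ K
  isCompact : IsCompact K
  mem00 : ((0, 0) : ℝ × ℝ) ∈ K
  mem10 : ((1, 0) : ℝ × ℝ) ∈ K
  mem11 : ((1, 1) : ℝ × ℝ) ∈ K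
  mem01 : ((0, 1) : ℝ × ℝ) ∈ K
  le11 : ∀ x ∈ K, A * (x.1 - 1) + B * (x.2 - 1) ≤ 0
  le00 : ∀ x ∈ K, 0 ≤ (1 - A) * x.1 + (1 - B) * x.2
  le10 : ∀ x ∈ K, (1 - A) * (x.1 - 1) ≤ B * x.2
  le01 : ∀ x ∈ K, (1 - B) * (x.2 - 1) ≤ A * x.1

namespace IsBalanced

variable {K : Set (ℝ × ℝ)} {A B : ℝ}

theorem A_nonneg (h : IsBalanced K A B) : 0 ≤ A := by
  have := h.le11 _ h.mem01; norm_num at this; exact this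

theorem B_nonneg (h : IsBalanced K A B) : 0 ≤ B := by
  have := h.le11 _ h.mem10; norm_num at this; exact this

theorem A_le_one (h : IsBalanced K A B) : A ≤ 1 := by
  have := h.le00 _ h.mem10; norm_num at this; exact this

theorem B_le_one (h : IsBalanced K A B) : B ≤ 1 := by
  have := h.le00 _ h.mem01; norm_num at this; exact this

theorem A_pos_of_one_lt (h : IsBalanced K A B) {x : ℝ × ℝ} (hx : x ∈ K) (h1 : 1 < x.2) :
    0 < A := by
  refine h.A_nonneg.lt_of_ne' fun hA => ?_
  have e1 := h.le11 x hx
  have e2 := h.le01 x hx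
  rw [hA] at e1 e2
  nlinarith

theorem B_pos_of_one_lt (h : IsBalanced K A B) {x : ℝ × ℝ} (hx : x ∈ K) (h1 : 1 < x.1) :
    0 < B := by
  refine h.B_nonneg.lt_of_ne' fun hB => ?_
  have e1 := h.le11 x hx
  have e2 := h.le10 x hx
  rw [hB] at e1 e2
  nlinarith

theorem fst_mem_of_one_lt_snd (h : IsBalanced K A B) {x : ℝ × ℝ} (hx : x ∈ K) (h1 : 1 < x.2) :
    0 ≤ x.1 ∧ x.1 ≤ 1 := by
  have hA := h.A_pos_of_one_lt hx h1
  have e1 := h.le11 x hx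
  have e2 := h.le01 x hx
  have hB := h.B_nonneg
  have hB' := h.B_le_one
  constructor
  · by_contra! hc
    nlinarith
  · by_contra! hc
    nlinarith

theorem snd_mem_of_one_lt_fst (h : IsBalanced K A B) {x : ℝ × ℝ} (hx : x ∈ K) (h1 : 1 < x.1) :
    0 ≤ x.2 ∧ x.2 ≤ 1 := by
  have hB := h.B_pos_of_one_lt hx h1
  have e1 := h.le11 x hx
  have e2 := h.le10 x hx
  have hA := h.A_nonneg
  have hA' := h.A_le_one
  constructor
  · by_contra! hc
    nlinarith
  · by_contra! hc
    nlinarith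

theorem fst_mem_of_snd_neg (h : IsBalanced K A B) {x : ℝ × ℝ} (hx : x ∈ K) (h1 : x.2 < 0) :
    0 ≤ x.1 ∧ x.1 ≤ 1 := by
  have e1 := h.le00 x hx
  have e2 := h.le10 x hx
  have hB := h.B_nonneg
  have hB' := h.B_le_one
  have hA : 0 < 1 - A := by
    refine (sub_nonneg.2 h.A_le_one).lt_of_ne' fun hA => ?_
    rw [hA] at e1 e2
    nlinarith
  constructor
  · by_contra! hc
    nlinarith
  · by_contra! hc
    nlinarith

/-- Reflection in the line `x = 1 / 2`. -/
theorem reflect_fst (h : IsBalanced K A B) :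
    IsBalanced (frameMap (1, 0) (-1, 0) (0, 1) '' K) A (1 - B) where
  convex := h.convex.affine_image _
  isCompact := h.isCompact.image (AffineMap.continuous_of_finiteDimensional _)
  mem00 := ⟨_, h.mem10, by simp [frameMap_apply]⟩
  mem10 := ⟨_, h.mem00, by simp [frameMap_apply]⟩
  mem11 := ⟨_, h.mem01, by simp [frameMap_apply]⟩
  mem01 := ⟨_, h.mem11, by simp [frameMap_apply]⟩
  le11 := by
    rintro _ ⟨x, hx, rfl⟩; have := h.le01 x hx; rw [frameMap_apply]; dsimp only; linarith
  le00 := by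
    rintro _ ⟨x, hx, rfl⟩; have := h.le10 x hx; rw [frameMap_apply]; dsimp only; linarith
  le10 := by
    rintro _ ⟨x, hx, rfl⟩; have := h.le00 x hx; rw [frameMap_apply]; dsimp only; linarith
  le01 := by
    rintro _ ⟨x, hx, rfl⟩; have := h.le11 x hx; rw [frameMap_apply]; dsimp only; linarith

/-- Reflection in the line `y = 1 / 2`. -/
theorem reflect_snd (h : IsBalanced K A B) :
    IsBalanced (frameMap (0, 1) (1, 0) (0, -1) '' K) (1 - A) B where
  convex := h.convex.affine_image _
  isCompact := h.isCompact.image (AffineMap.continuous_of_finiteDimensional _)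
  mem00 := ⟨_, h.mem01, by simp [frameMap_apply]⟩
  mem10 := ⟨_, h.mem11, by simp [frameMap_apply]⟩
  mem11 := ⟨_, h.mem10, by simp [frameMap_apply]⟩
  mem01 := ⟨_, h.mem00, by simp [frameMap_apply]⟩
  le11 := by
    rintro _ ⟨x, hx, rfl⟩; have := h.le10 x hx; rw [frameMap_apply]; dsimp only; linarith
  le00 := by
    rintro _ ⟨x, hx, rfl⟩; have := h.le01 x hx; rw [frameMap_apply]; dsimp only; linarith
  le10 := by
    rintro _ ⟨x, hx, rfl⟩; have := h.le11 x hx; rw [frameMap_apply]; dsimp only; linarith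
  le01 := by
    rintro _ ⟨x, hx, rfl⟩; have := h.le00 x hx; rw [frameMap_apply]; dsimp only; linarith

/-! ### Lower bounds for the area -/

theorem volume_ne_top (h : IsBalanced K A B) : volume K ≠ ∞ := h.isCompact.measure_lt_top.ne

/-- The parts of `K` beyond the four sides of the unit square do not overlap. -/
theorem one_add_le_volume (h : IsBalanced K A B) {a₁ a₂ a₃ a₄ : ℝ}
    (h1 : a₁ ≤ volume.real (K ∩ {p | 1 < p.2})) (h2 : a₂ ≤ volume.real (K ∩ {p | 1 < p.1}))
    (h3 : a₃ ≤ volume.real (K ∩ {p | p.2 < 0})) (h4 : a₄ ≤ volume.real (K ∩ {p | p.1 < 0})) :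
    1 + a₁ + a₂ + a₃ + a₄ ≤ volume.real K := by
  have hm := h.isCompact.isClosed.measurableSet
  have m1 : MeasurableSet (K ∩ {p : ℝ × ℝ | 1 < p.2}) :=
    hm.inter (measurableSet_lt measurable_const measurable_snd)
  have m2 : MeasurableSet (K ∩ {p : ℝ × ℝ | 1 < p.1}) :=
    hm.inter (measurableSet_lt measurable_const measurable_fst)
  have m3 : MeasurableSet (K ∩ {p : ℝ × ℝ | p.2 < 0}) :=
    hm.inter (measurableSet_lt measurable_snd measurable_const)
  have m4 : MeasurableSet (K ∩ {p : ℝ × ℝ | p.1 < 0}) :=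
    hm.inter (measurableSet_lt measurable_fst measurable_const)
  have hfin : ∀ s ⊆ K, volume s ≠ ∞ := fun s hs =>
    ((measure_mono hs).trans_lt h.volume_ne_top.lt_top).ne
  set S : Set (ℝ × ℝ) := {p | (0 ≤ p.1 ∧ p.1 ≤ 1) ∧ 0 ≤ p.2 ∧ p.2 ≤ 1} with hS
  have h0 : 1 ≤ volume.real (K ∩ S) := by
    have hs : S = Icc 0 1 ×ˢ Icc 0 1 := by
      ext p; simp only [hS, mem_ofPred_eq, mem_prod, mem_Icc]
    have hsub : S ⊆ K := by
      rintro x ⟨⟨x1, x2⟩, x3, x4⟩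
      rcases le_total x.1 x.2 with hx | hx
      · exact mem_convex_of_dblArea_nonneg h.convex h.mem00 h.mem11 h.mem01
          (by norm_num [dblArea]) (by norm_num [dblArea]; linarith)
          (by norm_num [dblArea]; linarith) (by norm_num [dblArea]; linarith)
      · exact mem_convex_of_dblArea_nonneg h.convex h.mem00 h.mem10 h.mem11
          (by norm_num [dblArea]) (by norm_num [dblArea]; linarith)
          (by norm_num [dblArea]; linarith) (by norm_num [dblArea]; linarith)
    rw [inter_eq_self_of_subset_right hsub, hs, Measure.real, Measure.volume_eq_prod,
      Measure.prod_prod]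
    simp
  have hu : volume.real (K ∩ S ∪ (K ∩ {p | 1 < p.2} ∪ (K ∩ {p | 1 < p.1} ∪
      (K ∩ {p | p.2 < 0} ∪ K ∩ {p | p.1 < 0})))) ≤ volume.real K := by
    refine measureReal_mono ?_ h.volume_ne_top
    simp only [union_subset_iff, inter_subset_left, and_self]
  rw [measureReal_union ?_ (by measurability) (hfin _ (by simp)) (hfin _ (by simp)),
    measureReal_union ?_ (by measurability) (hfin _ (by simp)) (hfin _ (by simp)),
    measureReal_union ?_ (by measurability) (hfin _ (by simp)) (hfin _ (by simp)),
    measureReal_union ?_ (by measurability) (hfin _ (by simp)) (hfin _ (by simp))] at hu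
  · linarith
  · rw [Set.disjoint_left]
    rintro x ⟨hx, x3⟩ ⟨_, x4⟩
    simp only [mem_ofPred_eq] at x3 x4
    linarith [(h.fst_mem_of_snd_neg hx x3).1]
  · rw [Set.disjoint_left]
    rintro x ⟨hx, x2⟩ (⟨_, x3⟩ | ⟨_, x3⟩) <;> simp only [mem_ofPred_eq] at x2 x3
    · linarith [(h.fst_mem_of_snd_neg hx x3).2]
    · linarith
  · rw [Set.disjoint_left]
    rintro x ⟨hx, x2⟩ (⟨_, x3⟩ | ⟨_, x3⟩ | ⟨_, x3⟩) <;> simp only [mem_ofPred_eq] at x2 x3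
    · linarith [(h.fst_mem_of_one_lt_snd hx x2).2]
    · linarith
    · linarith [(h.fst_mem_of_one_lt_snd hx x2).1]
  · rw [Set.disjoint_left]
    rintro x ⟨hx, ⟨x1, x1'⟩, x2, x2'⟩ (⟨_, x3⟩ | ⟨_, x3⟩ | ⟨_, x3⟩ | ⟨_, x3⟩) <;>
      simp only [mem_ofPred_eq] at x3 <;> linarith

end IsBalanced

/-- An open triangle lies strictly beyond a line if its vertices lie weakly beyond it, not all
three on it. -/
theorem openTriangle_subset_of_le {a b c : ℝ × ℝ} {α β k : ℝ} (ha : k ≤ α * a.1 + β * a.2)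
    (hb : k ≤ α * b.1 + β * b.2) (hc : k ≤ α * c.1 + β * c.2)
    (hs : 3 * k < (α * a.1 + β * a.2) + (α * b.1 + β * b.2) + (α * c.1 + β * c.2)) :
    openTriangle a b c ⊆ {p | k < α * p.1 + β * p.2} := by
  rintro x ⟨h1, h2, h3⟩
  rw [mem_ofPred_eq]
  have hD := dblArea_add_add a b c x
  have key : dblArea a b c * (α * x.1 + β * x.2 - k) =
      dblArea b c x * (α * a.1 + β * a.2 - k) + dblArea c a x * (α * b.1 + β * b.2 - k) +
      dblArea a b x * (α * c.1 + β * c.2 - k) := by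
    unfold dblArea; ring
  have p1 := mul_nonneg h2.le (sub_nonneg.2 ha)
  have p2 := mul_nonneg h3.le (sub_nonneg.2 hb)
  have p3 := mul_nonneg h1.le (sub_nonneg.2 hc)
  have hpos : 0 < dblArea a b c * (α * x.1 + β * x.2 - k) := by
    rw [key]
    by_cases e1 : k < α * a.1 + β * a.2
    · linarith [mul_pos h2 (sub_pos.2 e1)]
    by_cases e2 : k < α * b.1 + β * b.2
    · linarith [mul_pos h3 (sub_pos.2 e2)]
    · linarith [mul_pos h1 (show 0 < α * c.1 + β * c.2 - k by linarith)]
  linarith [pos_of_mul_pos_right hpos (by linarith : 0 ≤ dblArea a b c)]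

/-- A lower bound for the part of a convex set beyond a line, from the two triangles `a b c` and
`a c d`. -/
theorem fan_le_volume {K : Set (ℝ × ℝ)} (hK : Convex ℝ K) (hfin : volume K ≠ ∞)
    {a b c d : ℝ × ℝ} (ha : a ∈ K) (hb : b ∈ K) (hc : c ∈ K) (hd : d ∈ K) (α β k : ℝ)
    (h1 : 0 ≤ dblArea a b c) (h2 : 0 ≤ dblArea a c d)
    (ka : k ≤ α * a.1 + β * a.2) (kb : k ≤ α * b.1 + β * b.2) (kc : k < α * c.1 + β * c.2)
    (kd : k ≤ α * d.1 + β * d.2) {U : Set (ℝ × ℝ)} (hU : ∀ p, k < α * p.1 + β * p.2 → p ∈ U) :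
    (dblArea a b c + dblArea a c d) / 2 ≤ volume.real (K ∩ U) :=
  dblArea_add_le_volume hK hfin ha hb hc hd h1 h2
    ((openTriangle_subset_of_le ka kb kc.le (by linarith)).trans hU)
    ((openTriangle_subset_of_le ka kc.le kd (by linarith)).trans hU)

/-! ### The circumscribed rectangle and tilted support lines -/

/-- The rectangle `[-t₄, 1 + t₂] × [-t₃, 1 + t₁]` is the bounding box of `K`; it touches `K` on top
at `(p₁, 1 + t₁)` and on the right at `(1 + t₂, p₂)`. -/
structure IsBoundingBox (K : Set (ℝ × ℝ)) (p₁ p₂ t₁ t₂ t₃ t₄ : ℝ) : Prop where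
  mem_top : ((p₁, 1 + t₁) : ℝ × ℝ) ∈ K
  mem_right : ((1 + t₂, p₂) : ℝ × ℝ) ∈ K
  mem_bottom : ∃ p : ℝ, ((p, -t₃) : ℝ × ℝ) ∈ K
  mem_left : ∃ p : ℝ, ((-t₄, p) : ℝ × ℝ) ∈ K
  le_top : ∀ x ∈ K, x.2 ≤ 1 + t₁
  le_right : ∀ x ∈ K, x.1 ≤ 1 + t₂
  le_bottom : ∀ x ∈ K, -t₃ ≤ x.2
  le_left : ∀ x ∈ K, -t₄ ≤ x.1

namespace IsBalanced

variable {K : Set (ℝ × ℝ)} {A B p₁ p₂ t₁ t₂ t₃ t₄ : ℝ}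

theorem exists_isBoundingBox (h : IsBalanced K A B) :
    ∃ p₁ p₂ t₁ t₂ t₃ t₄, IsBoundingBox K p₁ p₂ t₁ t₂ t₃ t₄ := by
  have hne : K.Nonempty := ⟨_, h.mem00⟩
  obtain ⟨a, ha, ha'⟩ := h.isCompact.exists_isMaxOn hne continuous_snd.continuousOn
  obtain ⟨b, hb, hb'⟩ := h.isCompact.exists_isMaxOn hne continuous_fst.continuousOn
  obtain ⟨c, hc, hc'⟩ := h.isCompact.exists_isMinOn hne continuous_snd.continuousOn
  obtain ⟨d, hd, hd'⟩ := h.isCompact.exists_isMinOn hne continuous_fst.continuousOn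
  refine ⟨a.1, b.2, a.2 - 1, b.1 - 1, -c.2, -d.1, ?_, ?_, ⟨c.1, ?_⟩, ⟨d.2, ?_⟩, ?_, ?_, ?_, ?_⟩
  · simpa using ha
  · simpa using hb
  · simpa using hc
  · simpa using hd
  · intro x hx; have := ha' hx; simp at this ⊢; exact this
  · intro x hx; have := hb' hx; simp at this ⊢; exact this
  · intro x hx; have := hc' hx; simp at this ⊢; exact this
  · intro x hx; have := hd' hx; simp at this ⊢; exact this

theorem nonneg_of_isBoundingBox (h : IsBalanced K A B) (b : IsBoundingBox K p₁ p₂ t₁ t₂ t₃ t₄) :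
    0 ≤ t₁ ∧ 0 ≤ t₂ ∧ 0 ≤ t₃ ∧ 0 ≤ t₄ := by
  have h1 := b.le_top _ h.mem11
  have h2 := b.le_right _ h.mem11
  have h3 := b.le_bottom _ h.mem00
  have h4 := b.le_left _ h.mem00
  simp at h1 h2 h3 h4
  exact ⟨h1, h2, h3, h4⟩

theorem top_le_volume (h : IsBalanced K A B) (b : IsBoundingBox K p₁ p₂ t₁ t₂ t₃ t₄) :
    t₁ / 2 ≤ volume.real (K ∩ {p | 1 < p.2}) := by
  rcases (h.nonneg_of_isBoundingBox b).1.eq_or_lt with h0 | h0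
  · rw [← h0]; simp
  have := fan_le_volume h.convex h.volume_ne_top h.mem01 h.mem11 b.mem_top b.mem_top 0 1 1
    (by norm_num [dblArea]; exact h0.le) (by norm_num [dblArea]; linarith) (by norm_num)
    (by norm_num)
    (by norm_num; exact h0) (by norm_num; exact h0.le) (U := {p | 1 < p.2}) (by simp)
  norm_num [dblArea] at this
  linarith

theorem right_le_volume (h : IsBalanced K A B) (b : IsBoundingBox K p₁ p₂ t₁ t₂ t₃ t₄) :
    t₂ / 2 ≤ volume.real (K ∩ {p | 1 < p.1}) := by
  rcases (h.nonneg_of_isBoundingBox b).2.1.eq_or_lt with h0 | h0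
  · rw [← h0]; simp
  have := fan_le_volume h.convex h.volume_ne_top h.mem11 h.mem10 b.mem_right b.mem_right 1 0 1
    (by norm_num [dblArea]; exact h0.le) (by norm_num [dblArea]; linarith) (by norm_num)
    (by norm_num) (by norm_num; exact h0) (by norm_num; exact h0.le) (U := {p | 1 < p.1}) (by simp)
  norm_num [dblArea] at this
  linarith

theorem bottom_le_volume (h : IsBalanced K A B) (b : IsBoundingBox K p₁ p₂ t₁ t₂ t₃ t₄) :
    t₃ / 2 ≤ volume.real (K ∩ {p | p.2 < 0}) := by
  rcases (h.nonneg_of_isBoundingBox b).2.2.1.eq_or_lt with h0 | h0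
  · rw [← h0]; simp
  obtain ⟨p, hp⟩ := b.mem_bottom
  have := fan_le_volume h.convex h.volume_ne_top h.mem10 h.mem00 hp hp 0 (-1) 0
    (by norm_num [dblArea]; exact h0.le) (by norm_num [dblArea]; linarith) (by norm_num)
    (by norm_num) (by norm_num; exact h0) (by norm_num; exact h0.le) (U := {p | p.2 < 0}) (by simp)
  norm_num [dblArea] at this
  linarith

theorem left_le_volume (h : IsBalanced K A B) (b : IsBoundingBox K p₁ p₂ t₁ t₂ t₃ t₄) :
    t₄ / 2 ≤ volume.real (K ∩ {p | p.1 < 0}) := by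
  rcases (h.nonneg_of_isBoundingBox b).2.2.2.eq_or_lt with h0 | h0
  · rw [← h0]; simp
  obtain ⟨p, hp⟩ := b.mem_left
  have := fan_le_volume h.convex h.volume_ne_top h.mem00 h.mem01 hp hp (-1) 0 0
    (by norm_num [dblArea]; exact h0.le) (by norm_num [dblArea]; linarith) (by norm_num)
    (by norm_num) (by norm_num; exact h0) (by norm_num; exact h0.le) (U := {p | p.1 < 0}) (by simp)
  norm_num [dblArea] at this
  linarith

/-- Half the sum of the side lengths of the bounding box is a lower bound for the area. -/
theorem box_le_volume (h : IsBalanced K A B) (b : IsBoundingBox K p₁ p₂ t₁ t₂ t₃ t₄) :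
    1 + (t₁ + t₂ + t₃ + t₄) / 2 ≤ volume.real K := by
  have := h.one_add_le_volume (h.top_le_volume b) (h.right_le_volume b) (h.bottom_le_volume b)
    (h.left_le_volume b)
  linarith

theorem top_volume_le (h : IsBalanced K A B) (b : IsBoundingBox K p₁ p₂ t₁ t₂ t₃ t₄) {η : ℝ}
    (hη : volume.real K ≤ 1 + (t₁ + t₂ + t₃ + t₄) / 2 + η) :
    volume.real (K ∩ {p | 1 < p.2}) ≤ t₁ / 2 + η := by
  have := h.one_add_le_volume le_rfl (h.right_le_volume b) (h.bottom_le_volume b)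
    (h.left_le_volume b)
  linarith

theorem right_volume_le (h : IsBalanced K A B) (b : IsBoundingBox K p₁ p₂ t₁ t₂ t₃ t₄) {η : ℝ}
    (hη : volume.real K ≤ 1 + (t₁ + t₂ + t₃ + t₄) / 2 + η) :
    volume.real (K ∩ {p | 1 < p.1}) ≤ t₂ / 2 + η := by
  have := h.one_add_le_volume (h.top_le_volume b) le_rfl (h.bottom_le_volume b)
    (h.left_le_volume b)
  linarith

/-- The excess `g` of a point beyond a support line of slope `± 1 / 5` is at most `u / 5`, where
`u` is the distance of the contact point from the corner along the side, while `g * u` is at most twice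
the area of a triangle. The first bound is good for small `u`, the second for large `u`. -/
theorem excess_le {g u e : ℝ} (hu : g ≤ u / 5) (hgu : g * u ≤ e) (he : e ≤ 3 / 2000000) :
    g ≤ 3 / 5000 := by
  by_contra! hg
  nlinarith

/-- If `K` is not much larger than the octagon spanned by the unit square and the contact points of
the bounding box, then the support line of slope `-1 / 5` passes close to the topmost point: a
point of `K` well beyond it would either span a further triangle with the topmost point and
`(1, 1)`, or violate the bounding line through `(1, 1)`, which is steeper because `t₁ ≥ 1 / 5`. The
next three lemmas are the same for the other tilts and the right side. -/
theorem top_support_right (h : IsBalanced K A B) (b : IsBoundingBox K p₁ p₂ t₁ t₂ t₃ t₄)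
    (hη : volume.real K ≤ 1 + (t₁ + t₂ + t₃ + t₄) / 2 + 3 / 4000000) (ht : 1 / 5 ≤ t₁)
    {z : ℝ × ℝ} (hz : z ∈ K) : z.2 - (1 + t₁) + (z.1 - p₁) / 5 ≤ 3 / 5000 := by
  have htop := b.le_top z hz
  obtain ⟨hp0, hp1⟩ := h.fst_mem_of_one_lt_snd b.mem_top (by dsimp only; linarith)
  have hA := h.A_pos_of_one_lt b.mem_top (by dsimp only; linarith)
  dsimp only at hp0 hp1
  rcases le_total z.1 p₁ with h1 | h1
  · linarith
  rcases le_or_gt z.1 1 with h2 | h2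
  · rcases hp1.eq_or_lt with hp | hp
    · linarith
    refine excess_le (u := 1 - p₁) (e := (z.2 - 1) * (1 - p₁) - t₁ * (1 - z.1)) (by linarith)
      (by nlinarith) ?_
    by_contra! he
    have hz2 : 1 ≤ z.2 := by
      by_contra! hc
      nlinarith
    have := fan_le_volume h.convex h.volume_ne_top h.mem11 hz b.mem_top h.mem01 0 1 1
      (by norm_num [dblArea]; linarith) (by norm_num [dblArea]; linarith) (by norm_num)
      (by norm_num; exact hz2) (by norm_num; linarith) (by norm_num) (U := {p | 1 < p.2}) (by simp)
    have hle := h.top_volume_le b hη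
    norm_num [dblArea] at this
    linarith
  · have e1 := h.le11 z hz
    have e2 := h.le11 _ b.mem_top
    dsimp only at e2
    rcases h.B_nonneg.eq_or_lt with hB | hB
    · rw [← hB] at e1
      nlinarith
    · have hAB : B * (1 / 5) ≤ A := by nlinarith
      have : z.2 - (1 + t₁) + (z.1 - p₁) / 5 ≤ 0 := by
        by_contra! hc
        nlinarith
      linarith

theorem top_support_left (h : IsBalanced K A B) (b : IsBoundingBox K p₁ p₂ t₁ t₂ t₃ t₄)
    (hη : volume.real K ≤ 1 + (t₁ + t₂ + t₃ + t₄) / 2 + 3 / 4000000) (ht : 1 / 5 ≤ t₁)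
    {z : ℝ × ℝ} (hz : z ∈ K) : z.2 - (1 + t₁) - (z.1 - p₁) / 5 ≤ 3 / 5000 := by
  have htop := b.le_top z hz
  obtain ⟨hp0, hp1⟩ := h.fst_mem_of_one_lt_snd b.mem_top (by dsimp only; linarith)
  have hA := h.A_pos_of_one_lt b.mem_top (by dsimp only; linarith)
  dsimp only at hp0 hp1
  rcases le_total p₁ z.1 with h1 | h1
  · linarith
  rcases le_or_gt 0 z.1 with h2 | h2
  · rcases hp0.eq_or_lt with hp | hp
    · linarith
    refine excess_le (u := p₁) (e := (z.2 - 1) * p₁ - t₁ * z.1) (by linarith)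
      (by nlinarith) ?_
    by_contra! he
    have hz2 : 1 ≤ z.2 := by
      by_contra! hc
      nlinarith
    have := fan_le_volume h.convex h.volume_ne_top h.mem01 h.mem11 b.mem_top hz 0 1 1
      (by norm_num [dblArea]; linarith) (by norm_num [dblArea]; linarith) (by norm_num)
      (by norm_num) (by norm_num; linarith) (by norm_num; exact hz2) (U := {p | 1 < p.2}) (by simp)
    have hle := h.top_volume_le b hη
    norm_num [dblArea] at this
    linarith
  · have e1 := h.le01 z hz
    have e2 := h.le01 _ b.mem_top
    dsimp only at e2
    rcases (sub_nonneg.2 h.B_le_one).eq_or_lt with hB | hB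
    · rw [← hB] at e1
      nlinarith
    · have hAB : (1 - B) * (1 / 5) ≤ A := by nlinarith
      have : z.2 - (1 + t₁) - (z.1 - p₁) / 5 ≤ 0 := by
        by_contra! hc
        nlinarith
      linarith

theorem right_support_up (h : IsBalanced K A B) (b : IsBoundingBox K p₁ p₂ t₁ t₂ t₃ t₄)
    (hη : volume.real K ≤ 1 + (t₁ + t₂ + t₃ + t₄) / 2 + 3 / 4000000) (ht : 1 / 5 ≤ t₂)
    {z : ℝ × ℝ} (hz : z ∈ K) : z.1 - (1 + t₂) + (z.2 - p₂) / 5 ≤ 3 / 5000 := by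
  have hright := b.le_right z hz
  obtain ⟨hp0, hp1⟩ := h.snd_mem_of_one_lt_fst b.mem_right (by dsimp only; linarith)
  have hB := h.B_pos_of_one_lt b.mem_right (by dsimp only; linarith)
  dsimp only at hp0 hp1
  rcases le_total z.2 p₂ with h1 | h1
  · linarith
  rcases le_or_gt z.2 1 with h2 | h2
  · rcases hp1.eq_or_lt with hp | hp
    · linarith
    refine excess_le (u := 1 - p₂) (e := (z.1 - 1) * (1 - p₂) - t₂ * (1 - z.2)) (by linarith)
      (by nlinarith) ?_
    by_contra! he
    have hz2 : 1 ≤ z.1 := by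
      by_contra! hc
      nlinarith
    have := fan_le_volume h.convex h.volume_ne_top h.mem11 h.mem10 b.mem_right hz 1 0 1
      (by norm_num [dblArea]; linarith) (by norm_num [dblArea]; linarith) (by norm_num)
      (by norm_num) (by norm_num; linarith) (by norm_num; exact hz2) (U := {p | 1 < p.1}) (by simp)
    have hle := h.right_volume_le b hη
    norm_num [dblArea] at this
    linarith
  · have e1 := h.le11 z hz
    have e2 := h.le11 _ b.mem_right
    dsimp only at e2
    rcases h.A_nonneg.eq_or_lt with hA | hA
    · rw [← hA] at e1
      nlinarith
    · have hAB : A * (1 / 5) ≤ B := by nlinarith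
      have : z.1 - (1 + t₂) + (z.2 - p₂) / 5 ≤ 0 := by
        by_contra! hc
        nlinarith
      linarith

theorem right_support_down (h : IsBalanced K A B) (b : IsBoundingBox K p₁ p₂ t₁ t₂ t₃ t₄)
    (hη : volume.real K ≤ 1 + (t₁ + t₂ + t₃ + t₄) / 2 + 3 / 4000000) (ht : 1 / 5 ≤ t₂)
    {z : ℝ × ℝ} (hz : z ∈ K) : z.1 - (1 + t₂) - (z.2 - p₂) / 5 ≤ 3 / 5000 := by
  have hright := b.le_right z hz
  obtain ⟨hp0, hp1⟩ := h.snd_mem_of_one_lt_fst b.mem_right (by dsimp only; linarith)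
  have hB := h.B_pos_of_one_lt b.mem_right (by dsimp only; linarith)
  dsimp only at hp0 hp1
  rcases le_total p₂ z.2 with h1 | h1
  · linarith
  rcases le_or_gt 0 z.2 with h2 | h2
  · rcases hp0.eq_or_lt with hp | hp
    · linarith
    refine excess_le (u := p₂) (e := (z.1 - 1) * p₂ - t₂ * z.2) (by linarith)
      (by nlinarith) ?_
    by_contra! he
    have hz2 : 1 ≤ z.1 := by
      by_contra! hc
      nlinarith
    have := fan_le_volume h.convex h.volume_ne_top h.mem10 hz b.mem_right h.mem11 1 0 1
      (by norm_num [dblArea]; linarith) (by norm_num [dblArea]; linarith) (by norm_num)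
      (by norm_num; exact hz2) (by norm_num; linarith) (by norm_num) (U := {p | 1 < p.1}) (by simp)
    have hle := h.right_volume_le b hη
    norm_num [dblArea] at this
    linarith
  · have e1 := h.le10 z hz
    have e2 := h.le10 _ b.mem_right
    dsimp only at e2
    rcases (sub_nonneg.2 h.A_le_one).eq_or_lt with hA | hA
    · rw [← hA] at e1
      nlinarith
    · have hAB : (1 - A) * (1 / 5) ≤ B := by nlinarith
      have : z.1 - (1 + t₂) - (z.2 - p₂) / 5 ≤ 0 := by
        by_contra! hc
        nlinarith
      linarith

end IsBalanced

/-! ### The tilted quadrangle -/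

/-- The quadrangle with two perpendicular sides along the axes through `(x₀, y₀)` and the other two
tilted by the same slope `m`. If `K` has no small circumscribed quadrangle, its area bounds that of
`K`; for `m = 0` it is a rectangle. -/
theorem ratioBound_mul_le_tilted {K : Set (ℝ × ℝ)} (hK : ¬ HasSmallQuadrangle K)
    {x₀ y₀ w h m : ℝ} (hw : 0 < w) (hh : 0 < h) (h1 : 0 < h - m * w) (h2 : 0 < w + m * h)
    (kx : ∀ z ∈ K, x₀ ≤ z.1) (ky : ∀ z ∈ K, y₀ ≤ z.2)
    (kt : ∀ z ∈ K, (z.2 - y₀) + m * (z.1 - x₀) ≤ h)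
    (kr : ∀ z ∈ K, (z.1 - x₀) - m * (z.2 - y₀) ≤ w) :
    ratioBound * volume.real K * (1 + m ^ 2) ≤ w * h + m * (h ^ 2 - w ^ 2) / 2 := by
  by_contra! hlt
  have hm : 0 < 1 + m ^ 2 := by positivity
  set X := (w + m * h) / (1 + m ^ 2) with hX
  set Y := (h - m * w) / (1 + m ^ 2) with hY
  have hXpos : 0 < X := div_pos h2 hm
  have hYpos : 0 < Y := div_pos h1 hm
  have eX : X - m * Y = w := by rw [hX, hY]; field_simp; ring
  have eY : Y + m * X = h := by rw [hX, hY]; field_simp; ring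
  refine hK (hasSmallQuadrangle_of_dblArea (a := (x₀, y₀)) (b := (x₀ + w, y₀))
    (c := (x₀ + X, y₀ + Y)) (d := (x₀, y₀ + h)) ?_ ?_ ?_ ?_ ?_ ?_)
  · have : dblArea (x₀, y₀) (x₀ + w, y₀) (x₀ + X, y₀ + Y) = w * Y := by unfold dblArea; ring
    rw [this]; positivity
  · have : dblArea (x₀ + w, y₀) (x₀ + X, y₀ + Y) (x₀, y₀ + h) = Y * (w + m * h) := by
      unfold dblArea; linear_combination h * eX
    rw [this]; positivity
  · have : dblArea (x₀ + X, y₀ + Y) (x₀, y₀ + h) (x₀, y₀) = X * h := by unfold dblArea; ring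
    rw [this]; positivity
  · have : dblArea (x₀, y₀ + h) (x₀, y₀) (x₀ + w, y₀) = w * h := by unfold dblArea; ring
    rw [this]; positivity
  · intro z hz
    refine ⟨?_, ?_, ?_, ?_⟩
    · have : dblArea (x₀, y₀) (x₀ + w, y₀) z = w * (z.2 - y₀) := by unfold dblArea; ring
      rw [this]; exact mul_nonneg hw.le (sub_nonneg.2 (ky z hz))
    · have : dblArea (x₀ + w, y₀) (x₀ + X, y₀ + Y) z =
          Y * (w - ((z.1 - x₀) - m * (z.2 - y₀))) := by
        unfold dblArea; linear_combination (z.2 - y₀) * eX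
      rw [this]; exact mul_nonneg hYpos.le (sub_nonneg.2 (kr z hz))
    · have : dblArea (x₀ + X, y₀ + Y) (x₀, y₀ + h) z =
          X * (h - ((z.2 - y₀) + m * (z.1 - x₀))) := by
        unfold dblArea; linear_combination (z.1 - x₀) * eY
      rw [this]; exact mul_nonneg hXpos.le (sub_nonneg.2 (kt z hz))
    · have : dblArea (x₀, y₀ + h) (x₀, y₀) z = h * (z.1 - x₀) := by unfold dblArea; ring
      rw [this]; exact mul_nonneg hh.le (sub_nonneg.2 (kx z hz))
  · have e : (dblArea (x₀, y₀) (x₀ + w, y₀) (x₀ + X, y₀ + Y) +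
        dblArea (x₀ + X, y₀ + Y) (x₀, y₀ + h) (x₀, y₀)) / 2 =
        (w * h + m * (h ^ 2 - w ^ 2) / 2) / (1 + m ^ 2) := by
      unfold dblArea; rw [hX, hY]; field_simp; ring
    rw [e, div_lt_iff₀ hm]
    exact hlt

theorem ratioBound_nonneg : 0 ≤ ratioBound := by
  rw [ratioBound]; norm_num

theorem sq_ratioBound : ratioBound ^ 2 = 2 * (1 - 2.6 / 10 ^ 7) ^ 2 := by
  rw [ratioBound, mul_pow, Real.sq_sqrt (by norm_num)]; norm_num

theorem lt_ratioBound : 1.414213 < ratioBound := by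
  refine lt_of_pow_lt_pow_left₀ 2 ratioBound_nonneg ?_
  rw [sq_ratioBound]; norm_num

/-- Near-equality in both area bounds makes the bounding box nearly a square of side `√2`, and the
area nearly equal to its lower bound `(H + W) / 2`. -/
theorem near_square_of_ratioBound_mul_le {M H W : ℝ} (hlow : (H + W) / 2 ≤ M)
    (hpos : 0 < H + W) (h2 : ratioBound * M ≤ 2) (hbox : ratioBound * M ≤ W * H) :
    M ≤ (H + W) / 2 + 3 / 4000000 ∧ 1.41 ≤ H ∧ 1.41 ≤ W ∧ H + W ≤ 2.82843 ∧ W * H ≤ 2.00001 ∧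
      1.999998 ≤ ratioBound * M := by
  have hL := lt_ratioBound
  have hL0 := ratioBound_nonneg
  have hLsq : 1.99999895 ≤ ratioBound ^ 2 := by rw [sq_ratioBound]; norm_num
  obtain ⟨G, hG⟩ : ∃ G, G = (H + W) / 2 := ⟨_, rfl⟩
  obtain ⟨D, hD⟩ : ∃ D, D = (H - W) / 2 := ⟨_, rfl⟩
  have eH : H = G + D := by rw [hG, hD]; ring
  have eW : W = G - D := by rw [hG, hD]; ring
  rw [← hG] at hlow ⊢
  have hprod : W * H = G ^ 2 - D ^ 2 := by rw [eH, eW]; ring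
  have hGM : ratioBound * G ≤ ratioBound * M := mul_le_mul_of_nonneg_left hlow hL0
  have hG0 : 0 < G := by linarith
  have hLG : ratioBound ≤ G := by
    refine le_of_mul_le_mul_right ?_ hG0
    nlinarith [sq_nonneg D]
  have hLL : ratioBound ^ 2 ≤ ratioBound * G := by
    rw [sq]; exact mul_le_mul_of_nonneg_left hLG hL0
  have hη : M ≤ G + 3 / 4000000 := by
    by_contra! hc
    have : ratioBound * (3 / 4000000) ≤ ratioBound * (M - G) :=
      mul_le_mul_of_nonneg_left (by linarith) hL0
    linarith
  have hGup : G ≤ 1.414215 := by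
    by_contra! hc
    have : (1.414213 : ℝ) * 1.414215 ≤ ratioBound * G :=
      mul_le_mul hL.le hc.le (by norm_num) hL0
    linarith
  have hGsq : G ^ 2 ≤ 1.414215 ^ 2 := pow_le_pow_left₀ hG0.le hGup 2
  have hDsq : D ^ 2 ≤ 0.004 ^ 2 := by
    have : 1.99999895 ≤ W * H := by linarith
    linarith
  obtain ⟨hD1, hD2⟩ := abs_le_of_sq_le_sq' hDsq (by norm_num)
  refine ⟨hη, by linarith, by linarith, by linarith, ?_, by linarith⟩
  linarith [sq_nonneg D]

/-- With corner offsets `u, v` of the contact points, `u v ≥ t₁ t₂` is the convexity of `K` at the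
corner of the square; the gain is estimated by the inequality of the two means. -/
theorem four_mul_le_of_mul_le_mul {s t u v : ℝ} (hs : 0 ≤ s) (ht : 0 ≤ t) (hu : 0 ≤ u)
    (hv : 0 ≤ v) (h : s * t ≤ u * v) : 4 * (s * t) ≤ (t + u) * (s + v) := by
  have : 2 * (s * t) ≤ s * u + t * v := by
    refine le_of_sq_le_sq ?_ (by positivity)
    nlinarith [sq_nonneg (s * u - t * v), mul_le_mul_of_nonneg_left h (mul_nonneg hs ht)]
  linarith

namespace IsBalanced

variable {K : Set (ℝ × ℝ)} {A B p₁ p₂ t₁ t₂ t₃ t₄ : ℝ}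

/-- The quadrangle bounded by the lines through the corners of the square has area `2`. It may
degenerate to a triangle, so it is enlarged by `δ` along both diagonals. -/
theorem ratioBound_mul_le_two (h : IsBalanced K A B) (hK : ¬ HasSmallQuadrangle K) :
    ratioBound * volume.real K ≤ 2 := by
  have hA := h.A_nonneg
  have hA' := h.A_le_one
  have hB := h.B_nonneg
  have hB' := h.B_le_one
  have key : ∀ δ : ℝ, 0 < δ → ratioBound * volume.real K ≤ 2 * (1 + δ) ^ 2 := by
    intro δ hδ
    by_contra! hlt
    set E : ℝ × ℝ := (1 + B + δ, 1 - A) with hE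
    set N : ℝ × ℝ := (1 - B, 1 + A + δ) with hN
    set W : ℝ × ℝ := (B - 1 - δ, 1 - A) with hW
    set S : ℝ × ℝ := (1 - B, A - 1 - δ) with hS
    have f0 : dblArea E N W = 2 * (1 + δ) * (2 * A + δ) := by
      simp only [dblArea, hE, hN, hW]; ring
    have f1 : dblArea N W S = 2 * (1 + δ) * (2 * (1 - B) + δ) := by
      simp only [dblArea, hS, hN, hW]; ring
    have f2 : dblArea W S E = 2 * (1 + δ) * (2 * (1 - A) + δ) := by
      simp only [dblArea, hE, hS, hW]; ring
    have f3 : dblArea S E N = 2 * (1 + δ) * (2 * B + δ) := by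
      simp only [dblArea, hE, hN, hS]; ring
    refine hK (hasSmallQuadrangle_of_dblArea (a := E) (b := N) (c := W) (d := S) ?_ ?_ ?_ ?_ ?_ ?_)
    · rw [f0]; positivity
    · rw [f1]; have : 0 ≤ 1 - B := by linarith
      positivity
    · rw [f2]; have : 0 ≤ 1 - A := by linarith
      positivity
    · rw [f3]; positivity
    · intro z hz
      have e1 := h.le11 z hz
      have e2 := h.le01 z hz
      have e3 := h.le00 z hz
      have e4 := h.le10 z hz
      have g1 : 0 ≤ δ * (1 + B - z.1) := mul_nonneg hδ.le (by linarith)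
      have g2 : 0 ≤ δ * (1 + A - z.2) := mul_nonneg hδ.le (by linarith)
      have g3 : 0 ≤ δ * (z.1 + (1 - B)) := mul_nonneg hδ.le (by linarith)
      have g4 : 0 ≤ δ * (z.2 + (1 - A)) := mul_nonneg hδ.le (by linarith)
      have hδ2 : 0 ≤ δ ^ 2 := by positivity
      simp only [dblArea, hE, hN, hW, hS]
      refine ⟨?_, ?_, ?_, ?_⟩ <;> linarith
    · rw [f0, f2]
      linarith
  refine le_of_forall_pos_le_add fun ε hε => ?_
  have hδ : 0 < min 1 (ε / 6) := by positivity
  have h1 := key _ hδ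
  have h2 := min_le_left 1 (ε / 6)
  have h3 := min_le_right 1 (ε / 6)
  nlinarith

/-- Tilting the top and the right side of the bounding box about their contact points, by slopes
`1 / 5` or `-1 / 5` and with the lines of the other two sides fixed,
changes the area to first order by opposite amounts. In second order the average of the two areas
lies below the area of the box, by a margin that outweighs all the errors. -/
theorem hasSmallQuadrangle_of_le (h : IsBalanced K A B) (b : IsBoundingBox K p₁ p₂ t₁ t₂ t₃ t₄)
    (h13 : t₃ ≤ t₁) (h24 : t₄ ≤ t₂) : HasSmallQuadrangle K := by
  by_contra hK
  obtain ⟨ht1, ht2, ht3, ht4⟩ := h.nonneg_of_isBoundingBox b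
  obtain ⟨H, hH⟩ : ∃ H, H = 1 + t₁ + t₃ := ⟨_, rfl⟩
  obtain ⟨W, hW⟩ : ∃ W, W = 1 + t₂ + t₄ := ⟨_, rfl⟩
  have hbox : ratioBound * volume.real K ≤ W * H := by
    have := ratioBound_mul_le_tilted hK (x₀ := -t₄) (y₀ := -t₃) (w := W) (h := H) (m := 0)
      (by linarith) (by linarith) (by linarith) (by linarith) b.le_left b.le_bottom
      (fun z hz => by linarith [b.le_top z hz]) (fun z hz => by linarith [b.le_right z hz])
    linarith
  obtain ⟨hη, hHlow, hWlow, hHW, hWH, hLM⟩ := near_square_of_ratioBound_mul_le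
    (by linarith [h.box_le_volume b]) (by linarith) (h.ratioBound_mul_le_two hK) hbox
  replace hη : volume.real K ≤ 1 + (t₁ + t₂ + t₃ + t₄) / 2 + 3 / 4000000 := by linarith
  have ht1' : 0.205 ≤ t₁ := by linarith
  have ht2' : 0.205 ≤ t₂ := by linarith
  obtain ⟨hp0, hp1⟩ := h.fst_mem_of_one_lt_snd b.mem_top (by dsimp only; linarith)
  obtain ⟨hq0, hq1⟩ := h.snd_mem_of_one_lt_fst b.mem_right (by dsimp only; linarith)
  dsimp only at hp0 hp1 hq0 hq1
  -- The corner `(1, 1)` separates the two contact points.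
  have hcorner : t₁ * t₂ ≤ (1 - p₁) * (1 - p₂) := by
    have hA := h.A_pos_of_one_lt b.mem_top (by dsimp only; linarith)
    have hB := h.B_pos_of_one_lt b.mem_right (by dsimp only; linarith)
    have e1 := h.le11 _ b.mem_top
    have e2 := h.le11 _ b.mem_right
    dsimp only at e1 e2
    have e3 : (B * t₁) * (A * t₂) ≤ (A * (1 - p₁)) * (B * (1 - p₂)) :=
      mul_le_mul (by linarith) (by linarith) (by positivity)
        (mul_nonneg hA.le (by linarith))
    have hAB : 0 < A * B := by positivity
    refine le_of_mul_le_mul_left ?_ hAB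
    linarith
  have hgain := four_mul_le_of_mul_le_mul ht1 ht2 (sub_nonneg.2 hp1) (sub_nonneg.2 hq1) hcorner
  have ht12 : (0.205 : ℝ) * 0.205 ≤ t₁ * t₂ := mul_le_mul ht1' ht2' (by norm_num) ht1
  -- Contact points measured from the lower left corner of the bounding box.
  obtain ⟨a, ha⟩ : ∃ a, a = p₁ + t₄ := ⟨_, rfl⟩
  obtain ⟨c, hc⟩ : ∃ c, c = p₂ + t₃ := ⟨_, rfl⟩
  have s1 := ratioBound_mul_le_tilted hK (x₀ := -t₄) (y₀ := -t₃) (w := W + 3 / 5000 - c / 5)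
    (h := H + 3 / 5000 + a / 5) (m := 1 / 5) (by linarith) (by linarith) (by linarith)
    (by linarith) b.le_left b.le_bottom
    (fun z hz => by linarith [h.top_support_right b hη (by linarith) hz])
    (fun z hz => by linarith [h.right_support_down b hη (by linarith) hz])
  have s2 := ratioBound_mul_le_tilted hK (x₀ := -t₄) (y₀ := -t₃) (w := W + 3 / 5000 + c / 5)
    (h := H + 3 / 5000 - a / 5) (m := -1 / 5) (by linarith) (by linarith) (by linarith)
    (by linarith) b.le_left b.le_bottom
    (fun z hz => by linarith [h.top_support_left b hη (by linarith) hz])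
    (fun z hz => by linarith [h.right_support_up b hη (by linarith) hz])
  have hoff : (t₂ + (1 - p₁)) * (t₁ + (1 - p₂)) = (W - a) * (H - c) := by
    rw [hW, hH, ha, hc]; ring
  rw [hoff] at hgain
  have hslack : (W - a) * (H - c) ≤ (W + 3 / 5000 - a) * (H + 3 / 5000 - c) := by
    apply mul_le_mul <;> linarith
  -- In the average of `s1` and `s2` the first-order terms cancel; `1 / 26` is `m² / (1 + m²)`.
  have havg : ratioBound * volume.real K ≤ (W + 3 / 5000) * (H + 3 / 5000) -
      (W + 3 / 5000 - a) * (H + 3 / 5000 - c) / 26 := by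
    linarith
  linarith

end IsBalanced

theorem HasSmallQuadrangle.frameMap_image {K : Set (ℝ × ℝ)} (hK : HasSmallQuadrangle K)
    {o u w : ℝ × ℝ} (h : u.1 * w.2 - u.2 * w.1 ≠ 0) :
    HasSmallQuadrangle (frameMap o u w '' K) :=
  hK.image _ (frameMap_injective h) (abs_pos.2 h) fun s => by
    rw [Measure.real, volume_frameMap_image, ENNReal.toReal_mul,
      ENNReal.toReal_ofReal (abs_nonneg _), Measure.real]

namespace IsBalanced

variable {K : Set (ℝ × ℝ)} {A B : ℝ}

theorem hasSmallQuadrangle (h : IsBalanced K A B) : HasSmallQuadrangle K := by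
  -- By reflection, the top and the right side may be taken to be the farther ones.
  have of_bottom_le_top : ∀ {K : Set (ℝ × ℝ)} {A B p₁ p₂ t₁ t₂ t₃ t₄ : ℝ}, IsBalanced K A B →
      IsBoundingBox K p₁ p₂ t₁ t₂ t₃ t₄ → t₃ ≤ t₁ → HasSmallQuadrangle K := by
    intro K A B p₁ p₂ t₁ t₂ t₃ t₄ h b h13
    rcases le_total t₄ t₂ with h24 | h24
    · exact h.hasSmallQuadrangle_of_le b h13 h24
    obtain ⟨p, hp⟩ := b.mem_left
    obtain ⟨q, hq⟩ := b.mem_bottom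
    have b' : IsBoundingBox (frameMap (1, 0) (-1, 0) (0, 1) '' K) (1 - p₁) p t₁ t₄ t₃ t₂ :=
      { mem_top := ⟨_, b.mem_top, by simp [frameMap_apply]; ring⟩
        mem_right := ⟨_, hp, by simp [frameMap_apply]⟩
        mem_bottom := ⟨1 - q, _, hq, by simp [frameMap_apply]; ring⟩
        mem_left := ⟨p₂, _, b.mem_right, by simp [frameMap_apply]⟩
        le_top := by
          rintro _ ⟨x, hx, rfl⟩; have := b.le_top x hx; simp [frameMap_apply]; linarith
        le_right := by
          rintro _ ⟨x, hx, rfl⟩; have := b.le_left x hx; simp [frameMap_apply]; linarith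
        le_bottom := by
          rintro _ ⟨x, hx, rfl⟩; have := b.le_bottom x hx; simp [frameMap_apply]; linarith
        le_left := by
          rintro _ ⟨x, hx, rfl⟩; have := b.le_right x hx; simp [frameMap_apply]; linarith }
    have := (h.reflect_fst.hasSmallQuadrangle_of_le b' h13 h24).frameMap_image
      (o := (1, 0)) (u := (-1, 0)) (w := (0, 1)) (by norm_num)
    rw [image_image] at this
    simpa [frameMap_apply] using this
  obtain ⟨p₁, p₂, t₁, t₂, t₃, t₄, b⟩ := h.exists_isBoundingBox
  rcases le_total t₃ t₁ with h13 | h13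
  · exact of_bottom_le_top h b h13
  obtain ⟨p, hp⟩ := b.mem_bottom
  obtain ⟨q, hq⟩ := b.mem_left
  have b' : IsBoundingBox (frameMap (0, 1) (1, 0) (0, -1) '' K) p (1 - p₂) t₃ t₂ t₁ t₄ :=
    { mem_top := ⟨_, hp, by simp [frameMap_apply]⟩
      mem_right := ⟨_, b.mem_right, by simp [frameMap_apply]; ring⟩
      mem_bottom := ⟨p₁, _, b.mem_top, by simp [frameMap_apply]⟩
      mem_left := ⟨1 - q, _, hq, by simp [frameMap_apply]; ring⟩
      le_top := by
        rintro _ ⟨x, hx, rfl⟩; have := b.le_bottom x hx; simp [frameMap_apply]; linarith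
      le_right := by
        rintro _ ⟨x, hx, rfl⟩; have := b.le_right x hx; simp [frameMap_apply]; linarith
      le_bottom := by
        rintro _ ⟨x, hx, rfl⟩; have := b.le_top x hx; simp [frameMap_apply]; linarith
      le_left := by
        rintro _ ⟨x, hx, rfl⟩; have := b.le_left x hx; simp [frameMap_apply]; linarith }
  have := (of_bottom_le_top h.reflect_snd b' h13).frameMap_image
    (o := (0, 1)) (u := (1, 0)) (w := (0, -1)) (by norm_num)
  rw [image_image] at this
  simpa [frameMap_apply] using this

end IsBalanced

/-! ### Inscribed parallelograms of maximal area -/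

/-- First-order condition at the maximum: the left-hand side is twice the derivative of the area at
the unit square in the direction of the parallelogram `v₀ v₁ v₂ v₃`, and it equals `4` at the
square itself. -/
theorem linearized_area_le {K : Set (ℝ × ℝ)} (hK : Convex ℝ K)
    (h00 : ((0, 0) : ℝ × ℝ) ∈ K) (h10 : ((1, 0) : ℝ × ℝ) ∈ K) (h11 : ((1, 1) : ℝ × ℝ) ∈ K)
    (h01 : ((0, 1) : ℝ × ℝ) ∈ K)
    (hmax : ∀ v₀ ∈ K, ∀ v₁ ∈ K, ∀ v₂ ∈ K, ∀ v₃ ∈ K, v₀ + v₂ = v₁ + v₃ → dblArea v₀ v₁ v₃ ≤ 1)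
    {v₀ v₁ v₂ v₃ : ℝ × ℝ} (k0 : v₀ ∈ K) (k1 : v₁ ∈ K) (k2 : v₂ ∈ K) (k3 : v₃ ∈ K)
    (h : v₀ + v₂ = v₁ + v₃) :
    (v₂.1 + v₂.2) - (v₀.1 + v₀.2) + (v₃.2 - v₃.1) - (v₁.2 - v₁.1) ≤ 4 := by
  by_contra! hlt
  set D := (v₂.1 + v₂.2) - (v₀.1 + v₀.2) + (v₃.2 - v₃.1) - (v₁.2 - v₁.1) - 4 with hD
  have hDpos : 0 < D := by rw [hD]; linarith
  have e1 : v₀.1 + v₂.1 = v₁.1 + v₃.1 := congrArg Prod.fst h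
  have e2 : v₀.2 + v₂.2 = v₁.2 + v₃.2 := congrArg Prod.snd h
  -- The area along the segment from the square to `v` is `1 + s D / 2 + s² q`.
  obtain ⟨q, hq⟩ : ∃ q, q = (v₁.1 - v₀.1 - 1) * (v₃.2 - v₀.2 - 1) -
    (v₁.2 - v₀.2) * (v₃.1 - v₀.1) := ⟨_, rfl⟩
  have key : ∀ s : ℝ, 0 ≤ s → s ≤ 1 → s * (D / 2) + s ^ 2 * q ≤ 0 := by
    intro s hs hs1
    have hs' : 0 ≤ 1 - s := by linarith
    have := hmax _ (hK h00 k0 hs' hs (by ring)) _ (hK h10 k1 hs' hs (by ring))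
      _ (hK h11 k2 hs' hs (by ring)) _ (hK h01 k3 hs' hs (by ring)) (by
        ext
        · simp; linear_combination s * e1
        · simp; linear_combination s * e2)
    have e : dblArea ((1 - s) • (0, 0) + s • v₀) ((1 - s) • (1, 0) + s • v₁)
        ((1 - s) • (0, 1) + s • v₃) = 1 + s * (D / 2) + s ^ 2 * q := by
      unfold dblArea
      rw [hq, hD]
      simp
      linear_combination (s * (-1 / 2)) * e1 - (s / 2) * e2
    linarith
  have hs : 0 < min 1 (D / (4 * (|q| + 1))) := by positivity
  have k := key _ hs.le (min_le_left _ _)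
  set s := min 1 (D / (4 * (|q| + 1))) with hsdef
  have hle : s * (4 * (|q| + 1)) ≤ D := by
    rw [← le_div_iff₀ (by positivity)]; exact min_le_right _ _
  have hneg := neg_abs_le q
  have hfac : s * (D / 2 + s * q) ≤ 0 := by linarith
  have : 0 < D / 2 + s * q := by
    have := mul_le_mul_of_nonneg_left hneg hs.le
    linarith
  linarith [mul_pos hs this]

/-- Lagrange multipliers: the condition that the four vertices form a parallelogram is traded for
a linear term, by separating a convex set in `ℝ² × ℝ` from a point. The four vertices then vary
independently, and each one gives a line bounding `K`. -/
theorem exists_isBalanced_of_unitSquare_max {K : Set (ℝ × ℝ)} (hK : Convex ℝ K)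
    (hc : IsCompact K) (hint : (interior K).Nonempty)
    (h00 : ((0, 0) : ℝ × ℝ) ∈ K) (h10 : ((1, 0) : ℝ × ℝ) ∈ K) (h11 : ((1, 1) : ℝ × ℝ) ∈ K)
    (h01 : ((0, 1) : ℝ × ℝ) ∈ K)
    (hmax : ∀ v₀ ∈ K, ∀ v₁ ∈ K, ∀ v₂ ∈ K, ∀ v₃ ∈ K, v₀ + v₂ = v₁ + v₃ → dblArea v₀ v₁ v₃ ≤ 1) :
    ∃ A B, IsBalanced K A B := by
  obtain ⟨k, hk⟩ := hint
  let Φ : ((ℝ × ℝ) × (ℝ × ℝ) × (ℝ × ℝ) × (ℝ × ℝ)) × ℝ →ₗ[ℝ] (ℝ × ℝ) × ℝ :=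
    { toFun := fun q => (q.1.1 - q.1.2.1 + q.1.2.2.1 - q.1.2.2.2,
        (q.1.2.2.1.1 + q.1.2.2.1.2) - (q.1.1.1 + q.1.1.2) + (q.1.2.2.2.2 - q.1.2.2.2.1) -
          (q.1.2.1.2 - q.1.2.1.1) - q.2)
      map_add' := by intro x y; ext <;> simp <;> ring
      map_smul' := by intro x y; ext <;> simp <;> ring }
  have hΦ : ∀ q, Φ q = (q.1.1 - q.1.2.1 + q.1.2.2.1 - q.1.2.2.2,
        (q.1.2.2.1.1 + q.1.2.2.1.2) - (q.1.1.1 + q.1.1.2) + (q.1.2.2.2.2 - q.1.2.2.2.1) -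
          (q.1.2.1.2 - q.1.2.1.1) - q.2) := fun q => rfl
  have hsurj : Function.Surjective Φ := by
    rintro ⟨s, r⟩
    refine ⟨((s, 0, 0, 0), -(s.1 + s.2) - r), ?_⟩
    rw [hΦ]; simp
  let Ω : Set (((ℝ × ℝ) × (ℝ × ℝ) × (ℝ × ℝ) × (ℝ × ℝ)) × ℝ) :=
    (interior K ×ˢ interior K ×ˢ interior K ×ˢ interior K) ×ˢ Ioi 0
  have hΩo : IsOpen Ω :=
    (isOpen_interior.prod (isOpen_interior.prod (isOpen_interior.prod isOpen_interior))).prod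
      isOpen_Ioi
  have hΩc : Convex ℝ Ω :=
    (hK.interior.prod (hK.interior.prod (hK.interior.prod hK.interior))).prod (convex_Ioi 0)
  have hnot : ((0, 4) : (ℝ × ℝ) × ℝ) ∉ Φ '' Ω := by
    rintro ⟨⟨⟨v₀, v₁, v₂, v₃⟩, t⟩, ⟨⟨k0, k1, k2, k3⟩, kt⟩, hq⟩
    rw [hΦ, Prod.mk.injEq] at hq
    obtain ⟨q1, q2⟩ := hq
    dsimp only at q1 q2 k0 k1 k2 k3
    have kt' : 0 < t := kt
    have := linearized_area_le hK h00 h10 h11 h01 hmax (interior_subset k0) (interior_subset k1)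
      (interior_subset k2) (interior_subset k3) (by
        rw [← sub_eq_zero, ← q1]; abel)
    linarith
  obtain ⟨f, hf⟩ := geometric_hahn_banach_open_point (hΩc.linear_image Φ)
    (Φ.isOpenMap_of_finiteDimensional hsurj _ hΩo) hnot
  obtain ⟨α, hα⟩ : ∃ α, α = f ((1, 0), 0) := ⟨_, rfl⟩
  obtain ⟨β, hβ⟩ : ∃ β, β = f ((0, 1), 0) := ⟨_, rfl⟩
  obtain ⟨γ, hγ⟩ : ∃ γ, γ = f ((0, 0), 1) := ⟨_, rfl⟩
  have hfe : ∀ x y r : ℝ, f ((x, y), r) = x * α + y * β + r * γ := by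
    intro x y r
    have : (((x, y), r) : (ℝ × ℝ) × ℝ) = x • ((1, 0), 0) + y • ((0, 1), 0) + r • ((0, 0), 1) := by
      ext <;> simp
    rw [this, map_add, map_add, map_smul, map_smul, map_smul, hα, hβ, hγ]
    rfl
  have h4 : f (0, 4) = 4 * γ := by
    have := hfe 0 0 4
    rw [zero_mul, zero_mul, zero_add, zero_add] at this
    exact this
  have hsep : ∀ v₀ ∈ interior K, ∀ v₁ ∈ interior K, ∀ v₂ ∈ interior K, ∀ v₃ ∈ interior K,
      ∀ t : ℝ, 0 < t →
      (v₀.1 - v₁.1 + v₂.1 - v₃.1) * α + (v₀.2 - v₁.2 + v₂.2 - v₃.2) * β +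
        ((v₂.1 + v₂.2) - (v₀.1 + v₀.2) + (v₃.2 - v₃.1) - (v₁.2 - v₁.1) - t) * γ < 4 * γ := by
    intro v₀ k0 v₁ k1 v₂ k2 v₃ k3 t ht
    have := hf _ ⟨((v₀, v₁, v₂, v₃), t), ⟨⟨k0, k1, k2, k3⟩, ht⟩, rfl⟩
    rw [h4, hΦ] at this
    rw [← hfe]
    exact this
  have hγpos : 0 < γ := by
    have := hsep k hk k hk k hk k hk 1 one_pos
    linarith
  have hlag : ∀ v₀ ∈ K, ∀ v₁ ∈ K, ∀ v₂ ∈ K, ∀ v₃ ∈ K,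
      (v₀.1 - v₁.1 + v₂.1 - v₃.1) * α + (v₀.2 - v₁.2 + v₂.2 - v₃.2) * β +
        ((v₂.1 + v₂.2) - (v₀.1 + v₀.2) + (v₃.2 - v₃.1) - (v₁.2 - v₁.1)) * γ ≤ 4 * γ := by
    intro v₀ k0 v₁ k1 v₂ k2 v₃ k3
    by_contra! hlt
    obtain ⟨X, hX⟩ : ∃ X, X = (v₀.1 - v₁.1 + v₂.1 - v₃.1) * α +
        (v₀.2 - v₁.2 + v₂.2 - v₃.2) * β +
        ((v₂.1 + v₂.2) - (v₀.1 + v₀.2) + (v₃.2 - v₃.1) - (v₁.2 - v₁.1)) * γ := ⟨_, rfl⟩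
    rw [← hX] at hlt
    -- Shrinking towards the interior point `k` by the factor `1 - s` keeps the inequality false.
    obtain ⟨s, hs⟩ : ∃ s, s = (X - 4 * γ) / (X + γ) := ⟨_, rfl⟩
    have hXγ : 0 < X + γ := by linarith
    have hs0 : 0 < s := by rw [hs]; exact div_pos (by linarith) hXγ
    have hs1 : s < 1 := by rw [hs, div_lt_one hXγ]; linarith
    have hsX : s * (X + γ) = X - 4 * γ := by rw [hs]; exact div_mul_cancel₀ _ hXγ.ne'
    have hin : ∀ v ∈ K, s • k + (1 - s) • v ∈ interior K := fun v hv =>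
      hK.combo_interior_self_mem_interior hk hv hs0 (by linarith) (by ring)
    have := hsep _ (hin _ k0) _ (hin _ k1) _ (hin _ k2) _ (hin _ k3) s hs0
    simp only [Prod.fst_add, Prod.snd_add, Prod.smul_fst, Prod.smul_snd, smul_eq_mul] at this
    have e : (1 - s) * X - s * γ < 4 * γ := by
      refine lt_of_le_of_lt (le_of_eq ?_) this
      rw [hX]; ring
    linarith
  have hdiv : 0 < 2 * γ := by linarith
  refine ⟨(α + γ) / (2 * γ), (β + γ) / (2 * γ), hK, hc, h00, h10, h11, h01, ?_, ?_, ?_, ?_⟩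
  all_goals
    have a1 : 1 - (α + γ) / (2 * γ) = (γ - α) / (2 * γ) := by field_simp; ring
    have b1 : 1 - (β + γ) / (2 * γ) = (γ - β) / (2 * γ) := by field_simp; ring
    intro x hx
    try rw [a1]
    try rw [b1]
  · have := hlag _ h00 _ h10 x hx _ h01
    norm_num at this
    rw [div_mul_eq_mul_div, div_mul_eq_mul_div, ← add_div]
    exact div_nonpos_of_nonpos_of_nonneg (by linarith) hdiv.le
  · have := hlag x hx _ h10 _ h11 _ h01
    norm_num at this
    rw [div_mul_eq_mul_div, div_mul_eq_mul_div, ← add_div]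
    exact div_nonneg (by linarith) hdiv.le
  · have := hlag _ h00 x hx _ h11 _ h01
    norm_num at this
    rw [div_mul_eq_mul_div, div_mul_eq_mul_div, div_le_div_iff_of_pos_right hdiv]
    linarith
  · have := hlag _ h00 _ h10 _ h11 x hx
    norm_num at this
    rw [div_mul_eq_mul_div, div_mul_eq_mul_div, div_le_div_iff_of_pos_right hdiv]
    linarith

/-- Parallelograms are given by three vertices `v₀, v₁, v₃`, the fourth being `v₁ + v₃ - v₀`. -/
theorem exists_max_parallelogram {K : Set (ℝ × ℝ)} (hc : IsCompact K)
    (hint : (interior K).Nonempty) :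
    ∃ v₀ ∈ K, ∃ v₁ ∈ K, ∃ v₃ ∈ K, v₁ + v₃ - v₀ ∈ K ∧ 0 < dblArea v₀ v₁ v₃ ∧
      ∀ w₀ ∈ K, ∀ w₁ ∈ K, ∀ w₃ ∈ K, w₁ + w₃ - w₀ ∈ K → dblArea w₀ w₁ w₃ ≤ dblArea v₀ v₁ v₃ := by
  obtain ⟨k, hk⟩ := hint
  obtain ⟨ε, hε, hball⟩ := Metric.isOpen_iff.1 isOpen_interior k hk
  have hin : ∀ a b : ℝ, |a| < ε → |b| < ε → (k.1 + a, k.2 + b) ∈ K := fun a b ha hb =>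
    interior_subset (hball (by simp [Prod.dist_eq, ha, hb]))
  have he : |ε / 2| < ε := by rw [abs_of_pos] <;> linarith
  have h0 : |(0 : ℝ)| < ε := by simpa using hε
  set S : Set ((ℝ × ℝ) × (ℝ × ℝ) × (ℝ × ℝ)) :=
    (K ×ˢ K ×ˢ K) ∩ {q | q.2.1 + q.2.2 - q.1 ∈ K} with hS
  have hScomp : IsCompact S :=
    (hc.prod (hc.prod hc)).inter_right (hc.isClosed.preimage (by fun_prop))
  have hmem : ((k.1 + 0, k.2 + 0), (k.1 + ε / 2, k.2 + 0), (k.1 + 0, k.2 + ε / 2)) ∈ S := by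
    refine ⟨⟨hin _ _ h0 h0, hin _ _ he h0, hin _ _ h0 he⟩, ?_⟩
    have : ((k.1 + ε / 2, k.2 + 0) : ℝ × ℝ) + (k.1 + 0, k.2 + ε / 2) - (k.1 + 0, k.2 + 0) =
        (k.1 + ε / 2, k.2 + ε / 2) := by
      ext <;> simp
    rw [mem_ofPred_eq, this]
    exact hin _ _ he he
  obtain ⟨⟨v₀, v₁, v₃⟩, ⟨⟨k0, k1, k3⟩, k2⟩, hmax⟩ := hScomp.exists_isMaxOn ⟨_, hmem⟩
    (f := fun q => dblArea q.1 q.2.1 q.2.2) (by unfold dblArea; fun_prop)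
  refine ⟨v₀, k0, v₁, k1, v₃, k3, k2, ?_, fun w₀ h0 w₁ h1 w₃ h3 h2 => ?_⟩
  · have := hmax hmem
    simp [dblArea] at this
    simp only [dblArea]
    nlinarith
  · exact hmax (show (w₀, w₁, w₃) ∈ S from ⟨⟨h0, h1, h3⟩, h2⟩)

theorem hasSmallQuadrangle_of_convexBody {K : Set (ℝ × ℝ)} (hK : Convex ℝ K) (hc : IsCompact K)
    (hint : (interior K).Nonempty) : HasSmallQuadrangle K := by
  obtain ⟨v₀, k0, v₁, k1, v₃, k3, k2, hpos, hmax⟩ := exists_max_parallelogram hc hint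
  have hdet : (v₁ - v₀).1 * (v₃ - v₀).2 - (v₁ - v₀).2 * (v₃ - v₀).1 ≠ 0 := hpos.ne'
  set φ := frameMap v₀ (v₁ - v₀) (v₃ - v₀) with hφ
  let e := (AffineEquiv.ofBijective (φ := φ)
    ⟨frameMap_injective hdet, frameMap_surjective hdet⟩).toContinuousAffineEquiv.toHomeomorph
  have hdbl : ∀ x y z, dblArea (φ x) (φ y) (φ z) = dblArea v₀ v₁ v₃ * dblArea x y z := by
    intro x y z
    simp only [hφ, frameMap_apply, dblArea, Prod.fst_sub, Prod.snd_sub]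
    ring
  have hint' : (interior (φ ⁻¹' K)).Nonempty := by
    change (interior (e ⁻¹' K)).Nonempty
    rw [← e.preimage_interior]
    exact hint.preimage e.surjective
  have hc' : IsCompact (φ ⁻¹' K) := e.isCompact_preimage.2 hc
  obtain ⟨A, B, hbal⟩ := exists_isBalanced_of_unitSquare_max (hK.affine_preimage φ) hc' hint'
    (by rw [mem_preimage, hφ, frameMap_apply]; simpa using k0)
    (by rw [mem_preimage, hφ, frameMap_apply]; simpa using k1)
    (by
      have : φ (1, 1) = v₁ + v₃ - v₀ := by
        rw [hφ, frameMap_apply]; ext <;> simp <;> ring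
      rw [mem_preimage, this]; exact k2)
    (by rw [mem_preimage, hφ, frameMap_apply]; simpa using k3)
    (by
      intro w₀ h0 w₁ h1 w₂ h2 w₃ h3 hw
      have e2 : φ w₁ + φ w₃ - φ w₀ = φ w₂ := by
        have : w₂ = w₁ + w₃ - w₀ := by rw [← hw]; abel
        rw [this, hφ, frameMap_apply, frameMap_apply, frameMap_apply, frameMap_apply]
        ext <;> simp <;> ring
      have := hmax _ h0 _ h1 _ h3 (by rw [e2]; exact h2)
      rw [hdbl] at this
      exact le_of_mul_le_mul_left (by linarith) hpos)
  have := hbal.hasSmallQuadrangle.frameMap_image (o := v₀) hdet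
  rwa [← hφ, image_preimage_eq _ (frameMap_surjective hdet)] at this

/-! ### Transfer to the Euclidean plane -/

/-- Cartesian coordinates on the Euclidean plane. -/
noncomputable def planeCoords : Plane ≃L[ℝ] ℝ × ℝ :=
  (EuclideanSpace.equiv (Fin 2) ℝ).trans (ContinuousLinearEquiv.finTwoArrow ℝ ℝ)

theorem measurePreserving_planeCoords : MeasurePreserving planeCoords :=
  (volume_preserving_finTwoArrow ℝ).comp (PiLp.volume_preserving_ofLp (Fin 2))

theorem IsPlanarConvexBody.hasSmallQuadrangle {K : Set Plane} (h : IsPlanarConvexBody K) :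
    HasSmallQuadrangle K := by
  let e := planeCoords
  have hvol : ∀ s : Set (ℝ × ℝ), volume.real (e.symm '' s) = 1 * volume.real s := by
    intro s
    rw [one_mul, e.symm.image_eq_preimage_symm, ContinuousLinearEquiv.symm_symm, Measure.real,
      measurePreserving_planeCoords.measure_preimage_emb
        e.toHomeomorph.measurableEmbedding, Measure.real]
  have hK := hasSmallQuadrangle_of_convexBody (K := e '' K)
    (h.convex.linear_image e.toLinearEquiv.toLinearMap) (h.isCompact.image e.continuous)
    (by
      change (interior (e.toHomeomorph '' K)).Nonempty
      rw [← e.toHomeomorph.image_interior]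
      exact h.interior_nonempty.image _)
  have := hK.image e.symm.toLinearEquiv.toLinearMap.toAffineMap e.symm.injective one_pos hvol
  have him : e.symm.toLinearEquiv.toLinearMap.toAffineMap '' (e '' K) = K := by
    change e.symm '' (e '' K) = K
    exact e.symm_image_image K
  rwa [him] at this

theorem theorem1p1 :
    (∀ K : Set Plane, IsPlanarConvexBody K →
      ∃ Q : Set Plane, IsConvexQuadrangle Q ∧ K ⊆ Q ∧
        volume.real Q < (1 - 2.6 * 10 ^ (-7 : ℤ)) * √2 * volume.real K) ∧
    c4 ≤ ENNReal.ofReal ((1 - 2.6 * 10 ^ (-7 : ℤ)) * √2) := by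
  have main : ∀ K : Set Plane, IsPlanarConvexBody K →
      ∃ Q : Set Plane, IsConvexQuadrangle Q ∧ K ⊆ Q ∧
        volume.real Q < (1 - 2.6 * 10 ^ (-7 : ℤ)) * √2 * volume.real K := by
    intro K hK
    obtain ⟨v, hv, hKv, hlt⟩ := hK.hasSmallQuadrangle
    exact ⟨_, ⟨v, hv, rfl⟩, hKv, hlt⟩
  refine ⟨main, ?_⟩
  refine iSup₂_le fun K hK => ?_
  obtain ⟨Q, ⟨v, hv, rfl⟩, hKQ, hlt⟩ := main K hK
  refine (iInf₂_le _ ⟨⟨v, rfl⟩, hKQ⟩).trans ?_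
  have hK0 : volume K ≠ 0 :=
    ((isOpen_interior.measure_pos volume hK.interior_nonempty).trans_le
      (measure_mono interior_subset)).ne'
  have hKt : volume K ≠ ∞ := hK.isCompact.measure_lt_top.ne
  have hQt : volume (convexHull ℝ (range v)) ≠ ∞ :=
    ((finite_range v).isCompact_convexHull (𝕜 := ℝ)).measure_lt_top.ne
  rw [ENNReal.div_le_iff hK0 hKt, ← ENNReal.ofReal_toReal hKt,
    ← ENNReal.ofReal_mul (by norm_num), ← ENNReal.ofReal_toReal hQt]
  exact ENNReal.ofReal_le_ofReal hlt.le
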